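/- Let $N\ge 1$, let $K(y)=e^{|y|^2/4}$ on $\mathbb{R}^N$, and let $L^2(K)$ be the real Hilbert space of (classes of) measurable functions $v:\mathbb{R}^N\to\mathbb{R}$ with $\|v\|_K^2=\int |v|^2K\,dy<\infty$, with scalar product $(v,w)_K=\int vwK\,dy$. For $m\in\mathbb{N}$ let $H^m(K)$ be the space of $v$ whose weak derivatives $D^\alpha v$, $|\alpha|\le m$, lie in $L^2(K)$, with the norm $\|v\|_{m,K}^2=\sum_{|\alpha|\le m}\|D^\alpha v\|_K^2$. Let $Lv=-\Delta v-\frac{y\cdot\nabla v}{2}$ on $L^2(K)$, with domain $H^2(K)$, let $\varphi_1(y)=(4\pi)^{-N/4}e^{-|y|^2/4}$ be its first eigenfunction, $E_1=\mathrm{Span}\{\varphi_1\}$, and let $E_1^\perp$ be the orthogonal complement of $E_1$ in $L^2(K)$. Consider $$v_s+Lv-\tfrac N2 v=0\ \text{ in }\mathbb{R}^N\times(0,\infty),\qquad v(0)=u_0. \tag{1}$$ Then there is a strongly continuous semigroup of contractions $\{S(s)\}_{s\ge0}$ on $L^2(K)$, generated by $-(L-\frac N2I)$ with domain $H^2(K)$,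 such that the following holds. (i) For every $u_0\in L^2(K)$, $v(s)=S(s)u_0$ is the unique $v\in C([0,\infty);L^2(K))$ with $v(0)=u_0$ that satisfies the equation in (1) in the sense of distributions on $\mathbb{R}^N\times(0,\infty)$. Moreover $v\in C^\infty((0,\infty);H^m(K))$ for all $m\in\mathbb{N}$, and the equation holds in $L^2(K)$ for every $s>0$. (ii) For every $u_0\in L^2(K)$, $(v(s),\varphi_1)_K=(u_0,\varphi_1)_K$ for all $s\ge0$. (iii) There is $C>0$ with $\|v(s)\|_K\le Ce^{-s/2}\|u_0\|_K$ for all $s\ge0$ and $u_0\in E_1^\perp$; and for every $m\in\mathbb{N}$ there is $C_m>0$, independent of the initial data, with $\|v(s)\|_{m,K}\le C_me^{-s/2}\|u_0\|_K$ for all $s\ge1$ and $u_0\in E_1^\perp$. (iv) For all $s>0$ and $u_0\in E_1^\perp$, $$\Bigl\|\Bigl(L-\frac N2\Bigr)v(s)\Bigr\|_K\le\frac1{\sqrt2\,s}\|u_0\|_K,\qquad \|\nabla v(s)\|_K^2-\frac N2\|v(s)\|_K^2\le\frac1{2s}\|u_0\|_K^2 .$$ -/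

import Mathlib

open Set Filter Topology MeasureTheory
open scoped ContDiff InnerProductSpace Laplacian

namespace SimilarityHeat

/-- The Euclidean space `ℝ^N`. -/
abbrev Space (N : ℕ) : Type := EuclideanSpace ℝ (Fin N)

/-- The weight `K(y) = exp(|y|² / 4)`. -/
noncomputable def weight (N : ℕ) (y : Space N) : ℝ := Real.exp (‖y‖ ^ 2 / 4)

/-- The measure `K(y) dy`. -/
noncomputable def weightMeasure (N : ℕ) : Measure (Space N) :=
  (volume : Measure (Space N)).withDensity fun y => ENNReal.ofReal (weight N y)

/-- The real Hilbert space `L²(K)`, with scalar product `∫ v w K dy` and norm `‖·‖_K`.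
The measures `K dy` and `dy` have the same null sets, and `K ≥ 1`. -/
abbrev L2K (N : ℕ) : Type := Lp ℝ 2 (weightMeasure N)

theorem measurable_weight (N : ℕ) :
    Measurable fun y : Space N => ENNReal.ofReal (weight N y) := by
  unfold weight
  fun_prop

theorem volume_le_weightMeasure (N : ℕ) : (volume : Measure (Space N)) ≤ weightMeasure N := by
  conv_lhs => rw [← withDensity_one (μ := (volume : Measure (Space N)))]
  refine withDensity_mono (Eventually.of_forall fun y => ?_)
  simp only [Pi.one_apply, weight, ENNReal.one_le_ofReal]
  exact Real.one_le_exp (by positivity)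

theorem volume_absolutelyContinuous (N : ℕ) :
    (volume : Measure (Space N)) ≪ weightMeasure N :=
  Measure.absolutelyContinuous_of_le (volume_le_weightMeasure N)

/-- The partial derivative `∂φ/∂y_i`. -/
noncomputable def partialD {N : ℕ} (i : Fin N) (φ : Space N → ℝ) : Space N → ℝ :=
  fun y => fderiv ℝ φ y (EuclideanSpace.single i 1)

/-- The derivative `D^α φ = ∂_1^{α_1} ⋯ ∂_N^{α_N} φ` of a smooth function. -/
noncomputable def multiD {N : ℕ} (α : Fin N → ℕ) (φ : Space N → ℝ) : Space N → ℝ :=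
  (List.finRange N).foldr (fun i ψ => (partialD i)^[α i] ψ) φ

theorem partialD_smooth {N : ℕ} (i : Fin N) {φ : Space N → ℝ}
    (h : ContDiff ℝ ∞ φ ∧ HasCompactSupport φ) :
    ContDiff ℝ ∞ (partialD i φ) ∧ HasCompactSupport (partialD i φ) := by
  constructor
  · exact (h.1.fderiv_right (m := ∞) (by simp)).clm_apply contDiff_const
  · exact h.2.fderiv_apply ℝ _

theorem multiD_smooth {N : ℕ} (α : Fin N → ℕ) {φ : Space N → ℝ}
    (h : ContDiff ℝ ∞ φ ∧ HasCompactSupport φ) :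
    ContDiff ℝ ∞ (multiD α φ) ∧ HasCompactSupport (multiD α φ) := by
  unfold multiD
  induction List.finRange N with
  | nil => exact h
  | cons i l ih =>
    rw [List.foldr_cons]
    generalize α i = k
    induction k with
    | zero => exact ih
    | succ k ihk =>
      rw [Function.iterate_succ_apply']
      exact partialD_smooth i ihk

/-- `w = D^α v` in the sense of distributions on `ℝ^N`. -/
def HasWeakDeriv {N : ℕ} (α : Fin N → ℕ) (v w : L2K N) : Prop :=
  ∀ φ : Space N → ℝ, ContDiff ℝ ∞ φ → HasCompactSupport φ →
    ∫ y, v y * multiD α φ y = (-1 : ℝ) ^ (∑ i, α i) * ∫ y, w y * φ y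

theorem integrable_mul_test {N : ℕ} (v : L2K N) {φ : Space N → ℝ}
    (h1 : ContDiff ℝ ∞ φ) (h2 : HasCompactSupport φ) :
    Integrable (fun y => v y * φ y) (volume : Measure (Space N)) :=
  ((Lp.memLp v).mono_measure (volume_le_weightMeasure N)).integrable_mul
    (q := 2) (h1.continuous.memLp_of_hasCompactSupport h2)

theorem HasWeakDeriv.add {N : ℕ} {α : Fin N → ℕ} {v w v' w' : L2K N}
    (h : HasWeakDeriv α v w) (h' : HasWeakDeriv α v' w') :
    HasWeakDeriv α (v + v') (w + w') := by
  intro φ h1 h2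
  have key : ∀ (a b : L2K N) (ψ : Space N → ℝ), ContDiff ℝ ∞ ψ → HasCompactSupport ψ →
      ∫ y, (a + b : L2K N) y * ψ y = (∫ y, a y * ψ y) + ∫ y, b y * ψ y := by
    intro a b ψ p1 p2
    rw [← integral_add (integrable_mul_test a p1 p2) (integrable_mul_test b p1 p2)]
    refine integral_congr_ae ?_
    filter_upwards [(volume_absolutelyContinuous N).ae_le (Lp.coeFn_add a b)] with y hy
    rw [hy, Pi.add_apply, add_mul]
  obtain ⟨m1, m2⟩ := multiD_smooth α ⟨h1, h2⟩
  rw [key v v' _ m1 m2, key w w' _ h1 h2, h φ h1 h2, h' φ h1 h2, mul_add]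

theorem HasWeakDeriv.smul {N : ℕ} {α : Fin N → ℕ} {v w : L2K N} (c : ℝ)
    (h : HasWeakDeriv α v w) : HasWeakDeriv α (c • v) (c • w) := by
  intro φ h1 h2
  have key : ∀ (a : L2K N) (ψ : Space N → ℝ),
      ∫ y, (c • a : L2K N) y * ψ y = c * ∫ y, a y * ψ y := by
    intro a ψ
    rw [← integral_const_mul]
    refine integral_congr_ae ?_
    filter_upwards [(volume_absolutelyContinuous N).ae_le (Lp.coeFn_smul c a)] with y hy
    rw [hy, Pi.smul_apply, smul_eq_mul, mul_assoc]
  rw [key, key, h φ h1 h2]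
  ring

theorem HasWeakDeriv.zero {N : ℕ} {α : Fin N → ℕ} :
    HasWeakDeriv α (0 : L2K N) 0 := by
  have h0 : (0 : L2K N) = (0 : ℝ) • (0 : L2K N) := by simp
  intro φ h1 h2
  have key : ∀ ψ : Space N → ℝ, ∫ y, (0 : L2K N) y * ψ y = 0 := by
    intro ψ
    refine integral_eq_zero_of_ae ?_
    filter_upwards [(volume_absolutelyContinuous N).ae_le
      (Lp.coeFn_zero ℝ 2 (weightMeasure N))] with y hy
    rw [hy]
    simp
  rw [key, key, mul_zero]

/-- The multi-indices `α ∈ ℕ^N` with `|α| ≤ m`. -/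
def multiIndices (N m : ℕ) : Finset (Fin N → ℕ) :=
  (Fintype.piFinset fun _ : Fin N => Finset.range (m + 1)).filter fun α => ∑ i, α i ≤ m

theorem mem_multiIndices {N m : ℕ} {α : Fin N → ℕ} :
    α ∈ multiIndices N m ↔ ∑ i, α i ≤ m := by
  simp only [multiIndices, Finset.mem_filter, Fintype.mem_piFinset, Finset.mem_range,
    and_iff_right_iff_imp]
  intro h i
  have := Finset.single_le_sum (f := α) (fun _ _ => Nat.zero_le _) (Finset.mem_univ i)
  omega

/-- The multi-index `0`. -/
def zeroIndex (N m : ℕ) : multiIndices N m := ⟨0, mem_multiIndices.2 (by simp)⟩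

/-- The weighted Sobolev space `H^m(K)`. An element is the family `(D^α v)_{|α| ≤ m}` of the weak
derivatives of a function `v`, all of them in `L²(K)`; the family is determined by its entry `v` at
`α = 0`. The norm inherited from the Hilbert sum is `(∑_{|α| ≤ m} ‖D^α v‖_K²)^{1/2}`. -/
noncomputable def HK (N m : ℕ) : Submodule ℝ (PiLp 2 fun _ : multiIndices N m => L2K N) where
  carrier := {V | ∀ α : multiIndices N m, HasWeakDeriv α.1 (V (zeroIndex N m)) (V α)}
  add_mem' h h' α := (h α).add (h' α)
  zero_mem' _ := HasWeakDeriv.zero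
  smul_mem' c _ h α := (h α).smul c

/-- The inclusion of `H^m(K)` in `L²(K)`. -/
noncomputable def toL2K {N m : ℕ} (V : HK N m) : L2K N := V.1 (zeroIndex N m)

/-- `f = L v = -Δ v - (y · ∇ v) / 2`, where `v` lies in the domain `H²(K)` of `L` and `f` in
`L²(K)`. -/
def IsL {N : ℕ} (v f : L2K N) : Prop :=
  (∃ V : HK N 2, toL2K V = v) ∧
  ∃ g h : Fin N → L2K N,
    (∀ i, HasWeakDeriv (Pi.single i 1) v (g i)) ∧
    (∀ i, HasWeakDeriv (Pi.single i 2) v (h i)) ∧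
    ∀ᵐ y, f y = -(∑ i, h i y) - (∑ i, y i * g i y) / 2

/-- `v ∈ C([0,∞); L²(K))`, `v(0) = u₀`, and
`v_s - Δ v - (y · ∇ v) / 2 - (N / 2) v = 0` in the sense of distributions on `(0,∞) × ℝ^N`.
The formal adjoint of `v ↦ -(y · ∇ v) / 2` is `φ ↦ div (y φ) / 2 = (N φ + y · ∇ φ) / 2`. -/
structure IsSolution {N : ℕ} (u₀ : L2K N) (v : ℝ → L2K N) : Prop where
  continuousOn : ContinuousOn v (Ici 0)
  initial : v 0 = u₀
  equation : ∀ φ : ℝ → Space N → ℝ, ContDiff ℝ ∞ (Function.uncurry φ) →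
    HasCompactSupport (Function.uncurry φ) →
    tsupport (Function.uncurry φ) ⊆ Ioi 0 ×ˢ univ →
    ∫ s in Ioi (0 : ℝ), ∫ y, v s y *
      (-deriv (fun σ => φ σ y) s - (Δ (φ s)) y
        + (N * φ s y + fderiv ℝ (φ s) y y) / 2 - N / 2 * φ s y) = 0

/-- `v ∈ C^∞((0,∞); H^m(K))`. -/
def SmoothInHK {N : ℕ} (m : ℕ) (v : ℝ → L2K N) : Prop :=
  ∃ V : ℝ → HK N m, ContDiffOn ℝ ∞ V (Ioi 0) ∧ ∀ s, 0 < s → toL2K (V s) = v s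

/-- `(S(s))_{s ≥ 0}` is the strongly continuous semigroup of contractions on `L²(K)` generated by
`L - N/2` in the sign convention of the equation `v' + (L - N/2) v = 0`: the right derivative of
`S(s) u` at `s = 0` exists exactly for `u` in the domain of `L`, and equals `-(L u - (N/2) u)`. -/
structure IsHeatSemigroup {N : ℕ} (S : ℝ → L2K N →L[ℝ] L2K N) : Prop where
  zero : S 0 = ContinuousLinearMap.id ℝ (L2K N)
  add : ∀ s t, 0 ≤ s → 0 ≤ t → S (s + t) = (S s).comp (S t)
  continuousOn : ∀ u, ContinuousOn (fun s => S s u) (Ici 0)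
  contraction : ∀ s, 0 ≤ s → ‖S s‖ ≤ 1
  generator : ∀ u w : L2K N,
    Tendsto (fun h : ℝ => h⁻¹ • (S h u - u)) (𝓝[>] 0) (𝓝 w) ↔
      ∃ f, IsL u f ∧ w = -(f - ((N : ℝ) / 2) • u)

/-- The function `(4π)^{-N/4} exp(-|y|² / 4)`. -/
noncomputable def phiOneFun (N : ℕ) (y : Space N) : ℝ :=
  (4 * Real.pi) ^ (-(N : ℝ) / 4) * Real.exp (-‖y‖ ^ 2 / 4)

theorem integrable_gauss (N : ℕ) :
    Integrable (fun y : Space N => Real.exp (-(1 / 4) * ‖y‖ ^ 2)) := by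
  have h := (GaussianFourier.integrable_cexp_neg_mul_sq_norm_add (V := Space N)
    (b := (1 / 4 : ℂ)) (by norm_num) 0 0).norm
  refine h.congr (Eventually.of_forall fun y => ?_)
  simp only [Complex.norm_exp, zero_mul, add_zero]
  congr 1
  have : (-(1 / 4 : ℂ) * (‖y‖ : ℂ) ^ 2) = ((-(1 / 4) * ‖y‖ ^ 2 : ℝ) : ℂ) := by push_cast; ring
  rw [this, Complex.ofReal_re]

theorem memLp_phiOneFun (N : ℕ) : MemLp (phiOneFun N) 2 (weightMeasure N) := by
  have hc : Continuous (phiOneFun N) := by unfold phiOneFun; fun_prop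
  rw [memLp_two_iff_integrable_sq hc.aestronglyMeasurable, weightMeasure,
    integrable_withDensity_iff_integrable_smul' (measurable_weight N)
      (Eventually.of_forall fun _ => ENNReal.ofReal_lt_top)]
  refine ((integrable_gauss N).const_mul (((4 * Real.pi) ^ (-(N : ℝ) / 4)) ^ 2)).congr
    (Eventually.of_forall fun y => ?_)
  simp only [phiOneFun, weight, smul_eq_mul]
  rw [ENNReal.toReal_ofReal (Real.exp_pos _).le, mul_pow, ← Real.exp_nat_mul, mul_left_comm,
    ← Real.exp_add]
  congr 2
  push_cast
  ring

/-- The first eigenfunction `φ₁` of `L`, normalised in `L²(K)`. -/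
noncomputable def phiOne (N : ℕ) : L2K N := (memLp_phiOneFun N).toLp (phiOneFun N)

/-- The first eigenspace `E₁`, spanned by `φ₁`. -/
noncomputable def firstEigenspace (N : ℕ) : Submodule ℝ (L2K N) := Submodule.span ℝ {phiOne N}

end SimilarityHeat

/-!
The derivatives `D^β φ₁` of the Gaussian `φ₁` form, once normalised, an orthonormal basis of
`L²(K)`, on which `L - N/2` acts as multiplication by `|β|/2`. So `S(s)` multiplies the coefficient
of index `β` by `exp (-s|β|/2)`: on the complement of `φ₁`, where `|β| ≥ 1`, it decays like
`exp (-s/2)`, and the bounds on `(L - N/2) S(s)` and on the gradient reduce to `t exp (-t) ≤ 1`.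
A weak derivative `D^α` shifts the index `β` to `α + β` with a weight of polynomial growth in `β`,
which the exponential absorbs; hence the smoothing into every `H^m(K)`.

Uniqueness is read off coefficientwise. Integrating a distributional solution in time against a
test function yields an element of `L²(K)` for which `L` is known weakly. Testing with cut-off
Hermite polynomials, which are eigenfunctions of the formal adjoint of `L` with respect to `dy`,
shows that each coefficient `c` satisfies `c' = -(|β|/2) c` in the sense of distributions.
-/

namespace SimilarityHeat

/-! ### Diagonal semigroups on a Hilbert space -/

section HilbertBasis

variable {ι H : Type*} [NormedAddCommGroup H] [InnerProductSpace ℝ H] (b : HilbertBasis ι ℝ H)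

theorem ext_inner_hilbertBasis {u v : H} (h : ∀ i, inner ℝ (b i) u = inner ℝ (b i) v) : u = v :=
  b.repr.injective <| lp.ext <| funext fun i => by
    rw [b.repr_apply_apply, b.repr_apply_apply, h]

theorem hasSum_sq_inner (u : H) : HasSum (fun i => (inner ℝ (b i) u) ^ 2) (‖u‖ ^ 2) := by
  have h := b.hasSum_inner_mul_inner u u
  rw [real_inner_self_eq_norm_sq] at h
  refine h.congr_fun fun i => ?_
  rw [real_inner_comm u, sq]

theorem norm_le_of_abs_inner_le {u v : H} {C : ℝ} (hC : 0 ≤ C)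
    (h : ∀ i, |inner ℝ (b i) v| ≤ C * |inner ℝ (b i) u|) : ‖v‖ ≤ C * ‖u‖ := by
  refine le_of_sq_le_sq ?_ (by positivity)
  rw [mul_pow]
  refine hasSum_le (fun i => ?_) (hasSum_sq_inner b v) ((hasSum_sq_inner b u).mul_left (C ^ 2))
  rw [← sq_abs, ← sq_abs (inner ℝ (b i) u), ← mul_pow]
  exact pow_le_pow_left₀ (abs_nonneg _) (h i) 2

theorem tendsto_of_tendsto_inner {κ : Type*} {l : Filter κ} {v : κ → H} {u w : H} {C : ℝ}
    (hbound : ∀ᶠ n in l, ∀ i, |inner ℝ (b i) (v n - w)| ≤ C * |inner ℝ (b i) u|)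
    (hcoeff : ∀ i, Tendsto (fun n => inner ℝ (b i) (v n)) l (𝓝 (inner ℝ (b i) w))) :
    Tendsto v l (𝓝 w) := by
  rw [tendsto_iff_norm_sub_tendsto_zero]
  have hsq : Tendsto (fun n => ‖v n - w‖ ^ 2) l (𝓝 0) := by
    have htsum := tendsto_tsum_of_dominated_convergence (𝓕 := l)
      (f := fun n i => (inner ℝ (b i) (v n - w)) ^ 2) (g := fun _ => (0 : ℝ))
      ((hasSum_sq_inner b u).summable.mul_left (C ^ 2)) (fun i => ?_)
      (hbound.mono fun n hn i => ?_)
    · simpa only [(hasSum_sq_inner b _).tsum_eq, tsum_zero] using htsum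
    · simpa [inner_sub_right] using ((hcoeff i).sub_const (inner ℝ (b i) w)).pow 2
    · rw [Real.norm_eq_abs, abs_sq, ← sq_abs, ← sq_abs (inner ℝ (b i) u), ← mul_pow]
      exact pow_le_pow_left₀ (abs_nonneg _) (hn i) 2
  simpa using hsq.sqrt

end HilbertBasis

/-- Boundedness of a family of real numbers. -/
def IsBdd {ι : Type*} (a : ι → ℝ) : Prop := ∃ M, ∀ i, |a i| ≤ M

section WeightedShift

variable {ι H H' : Type*} [NormedAddCommGroup H] [InnerProductSpace ℝ H] [NormedAddCommGroup H']
  [InnerProductSpace ℝ H'] [CompleteSpace H'] (b : HilbertBasis ι ℝ H) {e : ι → H'}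
  (he : Orthonormal ℝ e) {a : ι → ℝ} (ha : IsBdd a)

theorem IsBdd.norm_smul_id_le {a : ι → ℝ} (ha : IsBdd a) (i : ι) :
    ‖a i • ContinuousLinearMap.id ℝ ℝ‖ ≤ |ha.choose| := by
  rw [norm_smul, Real.norm_eq_abs]
  exact (mul_le_of_le_one_right (abs_nonneg _) ContinuousLinearMap.norm_id_le).trans
    ((ha.choose_spec i).trans (le_abs_self _))

/-- The weighted shift `u ↦ ∑ i, a i (b i, u) e i` attached to a Hilbert basis `b`, an orthonormal
family `e` and a bounded family `a`; in the coordinates of `b` it is a multiplication operator on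
`ℓ²`. -/
noncomputable def weightedShift : H →L[ℝ] H' :=
  he.orthogonalFamily.linearIsometry.toContinuousLinearMap ∘L
    lp.mapCLM 2 (fun i => a i • ContinuousLinearMap.id ℝ ℝ) (abs_nonneg _) ha.norm_smul_id_le ∘L
    b.repr.toLinearIsometry.toContinuousLinearMap

theorem hasSum_weightedShift (u : H) :
    HasSum (fun i => (a i * inner ℝ (b i) u) • e i) (weightedShift b he ha u) := by
  have h := he.orthogonalFamily.hasSum_linearIsometry
    (lp.mapCLM 2 (fun i => a i • ContinuousLinearMap.id ℝ ℝ) (abs_nonneg _) ha.norm_smul_id_le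
      (b.repr u))
  refine h.congr_fun fun i => ?_
  simp [b.repr_apply_apply]

theorem inner_weightedShift (u : H) (i : ι) :
    inner ℝ (e i) (weightedShift b he ha u) = a i * inner ℝ (b i) u := by
  classical
  have h := (hasSum_weightedShift b he ha u).mapL (innerSL ℝ (e i))
  refine h.unique ((hasSum_ite_eq i (a i * inner ℝ (b i) u)).congr_fun fun j => ?_)
  simp only [innerSL_apply_apply, real_inner_smul_right, orthonormal_iff_ite.1 he]
  by_cases hij : j = i
  · simp [hij]
  · simp [hij, Ne.symm hij]

theorem hasSum_sq_weightedShift (u : H) :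
    HasSum (fun i => (a i * inner ℝ (b i) u) ^ 2) (‖weightedShift b he ha u‖ ^ 2) := by
  have h := (hasSum_weightedShift b he ha u).mapL (innerSL ℝ (weightedShift b he ha u))
  simp only [innerSL_apply_apply, real_inner_self_eq_norm_sq, real_inner_smul_right] at h
  refine h.congr_fun fun i => ?_
  rw [real_inner_comm (e i), inner_weightedShift, sq]

end WeightedShift

section Exponential

theorem mul_exp_neg_le_one (x : ℝ) : x * Real.exp (-x) ≤ 1 :=
  (Real.mul_exp_neg_le_exp_neg_one x).trans (Real.exp_le_one_iff.2 (by norm_num))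

theorem exp_neg_mul_mul_le {s : ℝ} (hs : 0 < s) (c : ℝ) :
    Real.exp (-(c * s)) * c ≤ Real.exp (-1) / s := by
  rw [le_div_iff₀ hs]
  linarith [Real.mul_exp_neg_le_exp_neg_one (c * s)]

theorem exp_neg_mul_le_one {c s : ℝ} (hc : 0 ≤ c) (hs : 0 ≤ s) : Real.exp (-(c * s)) ≤ 1 :=
  Real.exp_le_one_iff.2 (neg_nonpos.2 (mul_nonneg hc hs))

theorem hasDerivAt_exp_neg_mul (c s : ℝ) :
    HasDerivAt (fun σ => Real.exp (-(c * σ))) (-(Real.exp (-(c * s)) * c)) s := by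
  simpa using ((hasDerivAt_id s).const_mul c).neg.exp

theorem abs_slope_exp_neg_mul_le {c s t : ℝ} (hc : 0 ≤ c) (hs : 0 < s) (ht : |t| < s / 2) :
    |t⁻¹ * (Real.exp (-(c * (s + t))) - Real.exp (-(c * s)))| ≤ 2 / s := by
  have hderiv : ∀ σ ∈ Ioi (s / 2), ‖-(Real.exp (-(c * σ)) * c)‖ ≤ 2 / s := fun σ hσ => by
    have hσ' : 0 < σ := (half_pos hs).trans hσ
    rw [norm_neg, Real.norm_eq_abs, abs_of_nonneg (by positivity)]
    calc Real.exp (-(c * σ)) * c ≤ Real.exp (-1) / σ := exp_neg_mul_mul_le hσ' c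
      _ ≤ 1 / (s / 2) := by
        have := le_of_lt (show s / 2 < σ from hσ)
        gcongr
        exact Real.exp_le_one_iff.2 (by norm_num)
      _ = 2 / s := by rw [one_div_div]
  have hmem : s + t ∈ Ioi (s / 2) := show s / 2 < s + t by linarith [(abs_lt.1 ht).1]
  have hlip := (convex_Ioi (s / 2)).norm_image_sub_le_of_norm_hasDerivWithin_le
    (fun σ _ => (hasDerivAt_exp_neg_mul c σ).hasDerivWithinAt) hderiv (half_lt_self hs) hmem
  rw [add_sub_cancel_left, Real.norm_eq_abs, Real.norm_eq_abs] at hlip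
  rw [abs_mul, abs_inv, inv_mul_eq_div]
  exact div_le_of_le_mul₀ (abs_nonneg t) (by positivity) hlip

theorem tendsto_inv_mul_exp_sub_one (c : ℝ) :
    Tendsto (fun h : ℝ => h⁻¹ * (Real.exp (-(c * h)) - 1)) (𝓝[>] 0) (𝓝 (-c)) := by
  have h := hasDerivAt_iff_tendsto_slope_zero.1 (hasDerivAt_exp_neg_mul c 0)
  simp only [mul_zero, neg_zero, Real.exp_zero, one_mul, zero_add, smul_eq_mul] at h
  exact h.mono_left (nhdsWithin_mono _ fun x hx => ne_of_gt hx)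

theorem abs_inv_mul_exp_sub_one_add_le {c h : ℝ} (hc : 0 ≤ c) (hh : 0 < h) :
    |h⁻¹ * (Real.exp (-(c * h)) - 1) + c| ≤ c := by
  have hlower := Real.add_one_le_exp (-(c * h))
  have hupper := exp_neg_mul_le_one hc hh.le
  have hfactor : h⁻¹ * (Real.exp (-(c * h)) - 1) + c =
      h⁻¹ * (Real.exp (-(c * h)) - 1 + c * h) := by field_simp
  rw [hfactor, abs_of_nonneg (mul_nonneg (by positivity) (by linarith)), inv_mul_le_iff₀ hh]
  linarith

end Exponential

section DiagonalSemigroup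

variable {ι : Type*} {l : ι → ℝ}

theorem isBdd_exp (hl : ∀ i, 0 ≤ l i) {s : ℝ} (hs : 0 ≤ s) :
    IsBdd fun i => Real.exp (-(l i * s)) :=
  ⟨1, fun i => by
    rw [Real.abs_exp]
    exact exp_neg_mul_le_one (hl i) hs⟩

theorem isBdd_exp_mul (hl : ∀ i, 0 ≤ l i) {s : ℝ} (hs : 0 < s) :
    IsBdd fun i => Real.exp (-(l i * s)) * l i :=
  ⟨Real.exp (-1) / s, fun i => by
    rw [abs_of_nonneg (mul_nonneg (Real.exp_pos _).le (hl i))]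
    exact exp_neg_mul_mul_le hs _⟩

variable {H : Type*} [NormedAddCommGroup H] [InnerProductSpace ℝ H] [CompleteSpace H]
  (b : HilbertBasis ι ℝ H)

/-- The bounded diagonal operator `b i ↦ a i • b i`. -/
noncomputable def diagonal {a : ι → ℝ} (ha : IsBdd a) : H →L[ℝ] H :=
  weightedShift b b.orthonormal ha

theorem inner_diagonal {a : ι → ℝ} (ha : IsBdd a) (u : H) (i : ι) :
    inner ℝ (b i) (diagonal b ha u) = a i * inner ℝ (b i) u :=
  inner_weightedShift b b.orthonormal ha u i

theorem hasSum_diagonal {a : ι → ℝ} (ha : IsBdd a) (u : H) :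
    HasSum (fun i => (a i * inner ℝ (b i) u) • b i) (diagonal b ha u) :=
  hasSum_weightedShift b b.orthonormal ha u

variable (hl : ∀ i, 0 ≤ l i)

/-- The semigroup `exp (-s A)` of the diagonal operator `A : b i ↦ l i • b i`, extended by the
identity to negative times. -/
noncomputable def diagonalSemigroup (s : ℝ) : H →L[ℝ] H :=
  diagonal b (isBdd_exp hl (le_max_right s 0))

/-- The bounded operator `A exp (-s A)`, for `s > 0`. -/
noncomputable def diagonalSemigroupGen {s : ℝ} (hs : 0 < s) : H →L[ℝ] H :=
  diagonal b (isBdd_exp_mul hl hs)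

theorem inner_diagonalSemigroup {s : ℝ} (hs : 0 ≤ s) (u : H) (i : ι) :
    inner ℝ (b i) (diagonalSemigroup b hl s u) = Real.exp (-(l i * s)) * inner ℝ (b i) u := by
  rw [diagonalSemigroup, inner_diagonal, max_eq_left hs]

theorem inner_diagonalSemigroupGen {s : ℝ} (hs : 0 < s) (u : H) (i : ι) :
    inner ℝ (b i) (diagonalSemigroupGen b hl hs u) =
      Real.exp (-(l i * s)) * l i * inner ℝ (b i) u :=
  inner_diagonal b _ u i

theorem diagonalSemigroup_zero : diagonalSemigroup b hl 0 = ContinuousLinearMap.id ℝ H := by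
  ext1 u
  refine ext_inner_hilbertBasis b fun i => ?_
  rw [inner_diagonalSemigroup b hl le_rfl]
  simp

theorem diagonalSemigroup_add {s t : ℝ} (hs : 0 ≤ s) (ht : 0 ≤ t) :
    diagonalSemigroup b hl (s + t) =
      (diagonalSemigroup b hl s).comp (diagonalSemigroup b hl t) := by
  ext1 u
  refine ext_inner_hilbertBasis b fun i => ?_
  rw [ContinuousLinearMap.comp_apply, inner_diagonalSemigroup b hl (add_nonneg hs ht),
    inner_diagonalSemigroup b hl hs, inner_diagonalSemigroup b hl ht, ← mul_assoc, ← Real.exp_add]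
  congr 2
  ring

theorem diagonalSemigroup_diagonalSemigroupGen {s t : ℝ} (hs : 0 ≤ s) (ht : 0 < t)
    (u : H) : diagonalSemigroup b hl s (diagonalSemigroupGen b hl ht u) =
      diagonalSemigroupGen b hl (add_pos_of_nonneg_of_pos hs ht) u := by
  refine ext_inner_hilbertBasis b fun i => ?_
  rw [inner_diagonalSemigroup b hl hs, inner_diagonalSemigroupGen, inner_diagonalSemigroupGen,
    mul_add, neg_add, Real.exp_add]
  ring

theorem norm_diagonalSemigroup_apply_le {s c : ℝ} (hs : 0 ≤ s) {u : H}
    (hu : ∀ i, inner ℝ (b i) u = 0 ∨ c ≤ l i) :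
    ‖diagonalSemigroup b hl s u‖ ≤ Real.exp (-(c * s)) * ‖u‖ := by
  refine norm_le_of_abs_inner_le b (Real.exp_pos _).le fun i => ?_
  rw [inner_diagonalSemigroup b hl hs, abs_mul, Real.abs_exp]
  rcases hu i with hi | hi
  · simp [hi]
  · gcongr

theorem norm_diagonalSemigroup_le_one {s : ℝ} (hs : 0 ≤ s) : ‖diagonalSemigroup b hl s‖ ≤ 1 :=
  ContinuousLinearMap.opNorm_le_bound _ zero_le_one fun u => by
    simpa using norm_diagonalSemigroup_apply_le b hl hs (c := 0) (u := u) fun i => .inr (hl i)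

theorem norm_diagonalSemigroupGen_apply_le {s : ℝ} (hs : 0 < s) (u : H) :
    ‖diagonalSemigroupGen b hl hs u‖ ≤ Real.exp (-1) / s * ‖u‖ := by
  refine norm_le_of_abs_inner_le b (by positivity) fun i => ?_
  rw [inner_diagonalSemigroupGen, abs_mul,
    abs_of_nonneg (mul_nonneg (Real.exp_pos _).le (hl i))]
  exact mul_le_mul_of_nonneg_right (exp_neg_mul_mul_le hs _) (abs_nonneg _)

theorem continuous_diagonalSemigroup (u : H) : Continuous fun s => diagonalSemigroup b hl s u := by
  have hinner : ∀ s i, inner ℝ (b i) (diagonalSemigroup b hl s u) =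
      Real.exp (-(l i * max s 0)) * inner ℝ (b i) u := fun s i => inner_diagonal b _ u i
  refine continuous_iff_continuousAt.2 fun s₀ => ?_
  refine tendsto_of_tendsto_inner b (u := u) (C := 1)
    (Eventually.of_forall fun s i => ?_) fun i => ?_
  · rw [inner_sub_right, hinner, hinner, ← sub_mul, abs_mul]
    refine mul_le_mul_of_nonneg_right ?_ (abs_nonneg _)
    exact abs_sub_le_of_nonneg_of_le (Real.exp_pos _).le
      (exp_neg_mul_le_one (hl i) (le_max_right _ _)) (Real.exp_pos _).le
      (exp_neg_mul_le_one (hl i) (le_max_right _ _))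
  · simp only [hinner]
    exact (by fun_prop : Continuous fun s => Real.exp (-(l i * max s 0)) *
      inner ℝ (b i) u).tendsto s₀

theorem hasDerivAt_diagonalSemigroup {s : ℝ} (hs : 0 < s) (u : H) :
    HasDerivAt (fun σ => diagonalSemigroup b hl σ u) (-diagonalSemigroupGen b hl hs u) s := by
  rw [hasDerivAt_iff_tendsto_slope_zero]
  have hsmall : ∀ᶠ t in 𝓝[≠] (0 : ℝ), |t| < s / 2 :=
    (by simpa using eventually_norm_sub_lt (0 : ℝ) (half_pos hs) :
      ∀ᶠ t in 𝓝 (0 : ℝ), |t| < s / 2).filter_mono nhdsWithin_le_nhds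
  have hslope : ∀ t : ℝ, |t| < s / 2 → ∀ i,
      inner ℝ (b i) (t⁻¹ • (diagonalSemigroup b hl (s + t) u - diagonalSemigroup b hl s u)) =
        t⁻¹ * (Real.exp (-(l i * (s + t))) - Real.exp (-(l i * s))) * inner ℝ (b i) u :=
    fun t ht i => by
      rw [real_inner_smul_right, inner_sub_right, inner_diagonalSemigroup b hl hs.le,
        inner_diagonalSemigroup b hl (by linarith [(abs_lt.1 ht).1])]
      ring
  refine tendsto_of_tendsto_inner b (u := u) (C := 2 / s + Real.exp (-1) / s) ?_ fun i => ?_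
  · filter_upwards [hsmall] with t ht i
    rw [inner_sub_right, hslope t ht, inner_neg_right, inner_diagonalSemigroupGen, sub_neg_eq_add,
      ← add_mul, abs_mul]
    gcongr
    refine (abs_add_le _ _).trans (add_le_add (abs_slope_exp_neg_mul_le (hl i) hs ht) ?_)
    rw [abs_of_nonneg (mul_nonneg (Real.exp_pos _).le (hl i))]
    exact exp_neg_mul_mul_le hs _
  · rw [inner_neg_right, inner_diagonalSemigroupGen, ← neg_mul]
    refine ((hasDerivAt_iff_tendsto_slope_zero.1 (hasDerivAt_exp_neg_mul (l i) s)).mul_const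
      (inner ℝ (b i) u)).congr' ?_
    filter_upwards [hsmall] with t ht
    rw [hslope t ht, smul_eq_mul]

theorem contDiffOn_nat_diagonalSemigroup (n : ℕ) (u : H) :
    ContDiffOn ℝ n (fun s => diagonalSemigroup b hl s u) (Ioi 0) := by
  induction n generalizing u with
  | zero => exact contDiffOn_zero.2 (continuous_diagonalSemigroup b hl u).continuousOn
  | succ n ih =>
    push_cast
    rw [contDiffOn_succ_iff_deriv_of_isOpen isOpen_Ioi]
    refine ⟨fun s hs =>
      (hasDerivAt_diagonalSemigroup b hl hs u).differentiableAt.differentiableWithinAt,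
      by simp, fun s (hs : 0 < s) => ?_⟩
    -- Near `s` the derivative is `-exp (-(t - s/2) A)` applied to the fixed vector
    -- `A exp (-(s/2) A) u`, to which the induction hypothesis applies.
    have hs' := half_pos hs
    have hcomp : ContDiffAt ℝ n
        (fun t => -diagonalSemigroup b hl (t - s / 2) (diagonalSemigroupGen b hl hs' u)) s :=
      (((ih _).contDiffAt (Ioi_mem_nhds (sub_pos.2 (half_lt_self hs)))).comp s
        (contDiffAt_id.sub contDiffAt_const)).neg
    refine (hcomp.congr_of_eventuallyEq ?_).contDiffWithinAt
    filter_upwards [Ioi_mem_nhds (half_lt_self hs)] with t (ht : s / 2 < t)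
    rw [(hasDerivAt_diagonalSemigroup b hl (hs'.trans ht) u).deriv,
      diagonalSemigroup_diagonalSemigroupGen b hl (by linarith) hs']
    simp only [sub_add_cancel]

theorem contDiffOn_diagonalSemigroup (u : H) :
    ContDiffOn ℝ ∞ (fun s => diagonalSemigroup b hl s u) (Ioi 0) :=
  contDiffOn_infty.2 fun n => contDiffOn_nat_diagonalSemigroup b hl n u

theorem tendsto_slope_diagonalSemigroup_iff {u w : H} :
    Tendsto (fun h : ℝ => h⁻¹ • (diagonalSemigroup b hl h u - u)) (𝓝[>] 0) (𝓝 w) ↔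
      ∀ i, inner ℝ (b i) w = -l i * inner ℝ (b i) u := by
  have hslope : ∀ i, ∀ᶠ h : ℝ in 𝓝[>] 0,
      h⁻¹ * (Real.exp (-(l i * h)) - 1) * inner ℝ (b i) u =
        inner ℝ (b i) (h⁻¹ • (diagonalSemigroup b hl h u - u)) := fun i => by
    filter_upwards [self_mem_nhdsWithin] with h (hh : 0 < h)
    rw [real_inner_smul_right, inner_sub_right, inner_diagonalSemigroup b hl hh.le]
    ring
  have hlim : ∀ i, Tendsto (fun h => inner ℝ (b i) (h⁻¹ • (diagonalSemigroup b hl h u - u)))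
      (𝓝[>] 0) (𝓝 (-l i * inner ℝ (b i) u)) := fun i =>
    ((tendsto_inv_mul_exp_sub_one (l i)).mul_const _).congr' (hslope i)
  constructor
  · exact fun hw i => tendsto_nhds_unique (tendsto_const_nhds.inner hw) (hlim i)
  · intro hw
    refine tendsto_of_tendsto_inner b (u := w) (C := 1) ?_ fun i => (hw i).symm ▸ hlim i
    filter_upwards [self_mem_nhdsWithin] with h (hh : 0 < h) i
    rw [one_mul, inner_sub_right, hw, real_inner_smul_right, inner_sub_right,
      inner_diagonalSemigroup b hl hh.le, abs_mul, abs_neg, abs_of_nonneg (hl i)]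
    calc _ = |h⁻¹ * (Real.exp (-(l i * h)) - 1) + l i| * |inner ℝ (b i) u| := by
          rw [← abs_mul]
          ring_nf
      _ ≤ _ := mul_le_mul_of_nonneg_right (abs_inv_mul_exp_sub_one_add_le (hl i) hh)
          (abs_nonneg _)

end DiagonalSemigroup

/-! ### Hermite polynomials for the weight `exp(-x² / 4)` -/

/-- The operator `q ↦ q' - (X / 2) q`, conjugate to the derivative by the Gaussian
`e(x) = exp(-x² / 4)`: `(q e)' = (gaussDeriv q) e`. -/
noncomputable def gaussDeriv (q : Polynomial ℝ) : Polynomial ℝ :=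
  q.derivative - Polynomial.C (1 / 2) * Polynomial.X * q

theorem eval_gaussDeriv (q : Polynomial ℝ) (x : ℝ) :
    (gaussDeriv q).eval x = q.derivative.eval x - x / 2 * q.eval x := by
  simp only [gaussDeriv, Polynomial.eval_sub, Polynomial.eval_mul, Polynomial.eval_C,
    Polynomial.eval_X]
  ring

theorem hasDerivAt_polynomial_mul_gauss (q : Polynomial ℝ) (x : ℝ) :
    HasDerivAt (fun x : ℝ => q.eval x * Real.exp (-(1 / 4) * x ^ 2))
      ((gaussDeriv q).eval x * Real.exp (-(1 / 4) * x ^ 2)) x := by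
  convert! (q.hasDerivAt x).mul ((hasDerivAt_pow 2 x).const_mul (-(1 / 4 : ℝ))).exp using 1
  simp only [eval_gaussDeriv, Nat.cast_ofNat, Nat.add_one_sub_one, pow_one]
  ring

/-- The Hermite polynomials `p_n`, in the normalisation
`(d/dx)^n exp(-x² / 4) = p_n(x) exp(-x² / 4)`. -/
noncomputable def hermitePoly : ℕ → Polynomial ℝ
  | 0 => 1
  | n + 1 => gaussDeriv (hermitePoly n)

theorem eval_hermitePoly_succ (n : ℕ) (x : ℝ) :
    (hermitePoly (n + 1)).eval x =
      (hermitePoly n).derivative.eval x - x / 2 * (hermitePoly n).eval x :=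
  eval_gaussDeriv _ _

theorem derivative_hermitePoly_succ (n : ℕ) :
    (hermitePoly (n + 1)).derivative = Polynomial.C (-((n : ℝ) + 1) / 2) * hermitePoly n := by
  induction n with
  | zero => simp [hermitePoly, gaussDeriv, neg_div]
  | succ n ih =>
    refine Polynomial.funext fun x => ?_
    rw [hermitePoly, gaussDeriv, Polynomial.derivative_sub, mul_assoc,
      Polynomial.derivative_C_mul, Polynomial.derivative_mul, Polynomial.derivative_X, ih]
    simp only [Polynomial.derivative_C_mul, Polynomial.eval_sub, Polynomial.eval_add,
      Polynomial.eval_mul, Polynomial.eval_C, Polynomial.eval_X, Polynomial.eval_one,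
      eval_hermitePoly_succ]
    push_cast
    ring

theorem gaussDeriv_derivative_hermitePoly (n : ℕ) :
    gaussDeriv (hermitePoly n).derivative = Polynomial.C (-(n : ℝ) / 2) * hermitePoly n := by
  refine Polynomial.funext fun x => ?_
  cases n with
  | zero => simp [hermitePoly, gaussDeriv]
  | succ n =>
    simp only [eval_gaussDeriv, derivative_hermitePoly_succ, Polynomial.derivative_C_mul,
      Polynomial.eval_mul, Polynomial.eval_C, eval_hermitePoly_succ]
    push_cast
    ring

theorem mul_eval_hermitePoly (n : ℕ) (x : ℝ) :
    x * (hermitePoly n).eval x =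
      -2 * (hermitePoly (n + 1)).eval x + -(n : ℝ) * (hermitePoly (n - 1)).eval x := by
  cases n with
  | zero =>
    rw [eval_hermitePoly_succ]
    simp only [hermitePoly, Polynomial.derivative_one, Polynomial.eval_zero, Polynomial.eval_one,
      Nat.cast_zero]
    ring
  | succ n =>
    rw [eval_hermitePoly_succ (n + 1), derivative_hermitePoly_succ]
    simp only [Polynomial.eval_mul, Polynomial.eval_C, Nat.add_sub_cancel]
    push_cast
    ring

theorem integrable_polynomial_mul_gauss (q : Polynomial ℝ) :
    Integrable fun x : ℝ => q.eval x * Real.exp (-(1 / 4) * x ^ 2) := by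
  induction q using Polynomial.induction_on' with
  | add p q hp hq => simpa only [Polynomial.eval_add, add_mul] using! hp.add hq
  | monomial n a =>
    have hn : (-1 : ℝ) < n := neg_one_lt_zero.trans_le n.cast_nonneg
    refine ((integrable_rpow_mul_exp_neg_mul_sq (b := 1 / 4) (by norm_num) hn).const_mul a).congr
      (Eventually.of_forall fun x => ?_)
    simp only [Polynomial.eval_monomial, Real.rpow_natCast, mul_assoc]

/-- The scalar product `∫ p q exp(-x² / 4) dx` of two polynomials. -/
noncomputable def gaussInner (p q : Polynomial ℝ) : ℝ :=
  ∫ x : ℝ, p.eval x * q.eval x * Real.exp (-(1 / 4) * x ^ 2)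

theorem gaussInner_comm (p q : Polynomial ℝ) : gaussInner p q = gaussInner q p := by
  simp only [gaussInner, mul_comm (p.eval _)]

theorem gaussInner_C_mul_right (c : ℝ) (p q : Polynomial ℝ) :
    gaussInner p (Polynomial.C c * q) = c * gaussInner p q := by
  simp only [gaussInner, ← integral_const_mul, Polynomial.eval_mul, Polynomial.eval_C]
  congr 1 with x
  ring

theorem gaussInner_gaussDeriv_left (p q : Polynomial ℝ) :
    gaussInner (gaussDeriv p) q = -gaussInner p q.derivative := by
  have hint (r s : Polynomial ℝ) :
      Integrable fun x : ℝ => r.eval x * (s.eval x * Real.exp (-(1 / 4) * x ^ 2)) := by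
    simpa only [Polynomial.eval_mul, mul_assoc] using integrable_polynomial_mul_gauss (r * s)
  have h := integral_mul_deriv_eq_deriv_mul_of_integrable
    (fun x _ => q.hasDerivAt x) (fun x _ => hasDerivAt_polynomial_mul_gauss p x)
    (hint _ _) (hint _ _) (hint _ _)
  simpa only [gaussInner, mul_comm (Polynomial.eval _ p),
    mul_comm (Polynomial.eval _ (gaussDeriv p)), mul_assoc] using h

theorem gaussInner_hermitePoly_succ_zero (n : ℕ) :
    gaussInner (hermitePoly (n + 1)) (hermitePoly 0) = 0 := by
  rw [show hermitePoly (n + 1) = gaussDeriv (hermitePoly n) from rfl, gaussInner_gaussDeriv_left]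
  simp [gaussInner, hermitePoly]

theorem gaussInner_hermitePoly_succ_succ (n m : ℕ) :
    gaussInner (hermitePoly (n + 1)) (hermitePoly (m + 1)) =
      ((m : ℝ) + 1) / 2 * gaussInner (hermitePoly n) (hermitePoly m) := by
  rw [hermitePoly, gaussInner_gaussDeriv_left, derivative_hermitePoly_succ, gaussInner_C_mul_right]
  ring

theorem gaussInner_hermitePoly (n m : ℕ) :
    gaussInner (hermitePoly n) (hermitePoly m) =
      if n = m then (n.factorial : ℝ) / 2 ^ n * √(4 * Real.pi) else 0 := by
  induction n generalizing m with
  | zero =>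
    cases m with
    | zero =>
      have hgauss := integral_gaussian (1 / 4)
      rw [show Real.pi / (1 / 4) = 4 * Real.pi by ring] at hgauss
      simpa only [gaussInner, hermitePoly, Polynomial.eval_one, one_mul, if_pos, Nat.factorial_zero,
        Nat.cast_one, pow_zero, div_one] using hgauss
    | succ m => simp [gaussInner_comm (hermitePoly 0), gaussInner_hermitePoly_succ_zero]
  | succ n ih =>
    cases m with
    | zero => simp [gaussInner_hermitePoly_succ_zero]
    | succ m =>
      rw [gaussInner_hermitePoly_succ_succ, ih]
      by_cases h : n = m
      · subst h
        rw [if_pos rfl, if_pos rfl, Nat.factorial_succ, pow_succ]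
        push_cast
        field_simp
      · simp [h]

/-! ### Partial derivatives and tensor products of polynomials -/

section Tensor

variable {N : ℕ}

theorem fderiv_apply_eq_sum (φ : Space N → ℝ) (y z : Space N) :
    fderiv ℝ φ y z = ∑ i, z i * partialD i φ y := by
  conv_lhs => rw [← (EuclideanSpace.basisFun (Fin N) ℝ).sum_repr z]
  simp [partialD]

theorem partialD_mul (i : Fin N) {φ ψ : Space N → ℝ} {y : Space N}
    (hφ : DifferentiableAt ℝ φ y) (hψ : DifferentiableAt ℝ ψ y) :
    partialD i (fun y => φ y * ψ y) y = partialD i φ y * ψ y + φ y * partialD i ψ y := by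
  rw [partialD, fderiv_fun_mul hφ hψ]
  simp only [add_apply, smul_apply, smul_eq_mul, partialD]
  ring

theorem contDiff_partialD (i : Fin N) {φ : Space N → ℝ} (h : ContDiff ℝ ∞ φ) :
    ContDiff ℝ ∞ (partialD i φ) :=
  (h.fderiv_right (m := ∞) (by simp)).clm_apply contDiff_const

/-- The function `y ↦ ∏ j, q_j (y_j)`. -/
noncomputable def polyTensor (q : Fin N → Polynomial ℝ) (y : Space N) : ℝ :=
  ∏ j, (q j).eval (y j)

/-- The function `y ↦ (∏ j, q_j (y_j)) φ₁(y)`. -/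
noncomputable def gaussTensor (q : Fin N → Polynomial ℝ) (y : Space N) : ℝ :=
  polyTensor q y * phiOneFun N y

theorem contDiff_polyTensor (q : Fin N → Polynomial ℝ) : ContDiff ℝ ∞ (polyTensor q) :=
  contDiff_prod fun j _ =>
    (Polynomial.contDiff_aeval (q j) ∞).comp (contDiff_piLp_apply (p := 2) (i := j))

theorem contDiff_phiOneFun (N : ℕ) : ContDiff ℝ ∞ (phiOneFun N) :=
  contDiff_const.mul (((contDiff_norm_sq ℝ).neg.div_const 4).exp)

theorem contDiff_gaussTensor (q : Fin N → Polynomial ℝ) : ContDiff ℝ ∞ (gaussTensor q) :=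
  (contDiff_polyTensor q).mul (contDiff_phiOneFun N)

theorem polyTensor_update (q : Fin N → Polynomial ℝ) (i : Fin N) (r : Polynomial ℝ) (y : Space N) :
    polyTensor (Function.update q i r) y =
      r.eval (y i) * ∏ j ∈ Finset.univ.erase i, (q j).eval (y j) := by
  rw [polyTensor, ← Finset.mul_prod_erase _ _ (Finset.mem_univ i), Function.update_self]
  congr 1
  refine Finset.prod_congr rfl fun j hj => ?_
  rw [Function.update_of_ne (Finset.ne_of_mem_erase hj)]

theorem polyTensor_eq_mul_prod_erase (q : Fin N → Polynomial ℝ) (i : Fin N) (y : Space N) :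
    polyTensor q y = (q i).eval (y i) * ∏ j ∈ Finset.univ.erase i, (q j).eval (y j) := by
  rw [← polyTensor_update, Function.update_eq_self]

theorem partialD_polyTensor (i : Fin N) (q : Fin N → Polynomial ℝ) :
    partialD i (polyTensor q) = polyTensor (Function.update q i (q i).derivative) := by
  funext y
  have hfactor (j : Fin N) : HasFDerivAt (fun y : Space N => (q j).eval (y j))
      ((q j).derivative.eval (y j) • (EuclideanSpace.proj j : Space N →L[ℝ] ℝ)) y :=
    ((q j).hasDerivAt (y j)).comp_hasFDerivAt (f := fun y : Space N => y j) y
      (EuclideanSpace.proj j : Space N →L[ℝ] ℝ).hasFDerivAt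
  have hprod : HasFDerivAt (polyTensor q) _ y := HasFDerivAt.finsetProd fun j _ => hfactor j
  rw [partialD, hprod.fderiv, polyTensor_update]
  simp only [sum_apply, smul_apply, PiLp.proj_apply, PiLp.single_apply, smul_eq_mul]
  rw [Finset.sum_eq_single i (fun j _ hj => by simp [hj]) (by simp)]
  simp [mul_comm]

theorem partialD_phiOneFun (i : Fin N) (y : Space N) :
    partialD i (phiOneFun N) y = -(y i / 2) * phiOneFun N y := by
  have hexponent : HasFDerivAt (fun y : Space N => -‖y‖ ^ 2 / 4) _ y :=
    (hasStrictFDerivAt_norm_sq y).hasFDerivAt.neg.mul_const (4 : ℝ)⁻¹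
  have h : HasFDerivAt (phiOneFun N) _ y :=
    hexponent.exp.const_mul ((4 * Real.pi) ^ (-(N : ℝ) / 4))
  rw [partialD, h.fderiv]
  simp [phiOneFun, EuclideanSpace.inner_single_right]
  ring

theorem partialD_gaussTensor (i : Fin N) (q : Fin N → Polynomial ℝ) :
    partialD i (gaussTensor q) = gaussTensor (Function.update q i (gaussDeriv (q i))) := by
  funext y
  have h := partialD_mul i ((contDiff_polyTensor q).differentiable (by simp) y)
    ((contDiff_phiOneFun N).differentiable (by simp) y)
  rw [show gaussTensor q = fun y => polyTensor q y * phiOneFun N y from rfl, h,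
    partialD_polyTensor, partialD_phiOneFun, gaussTensor, polyTensor_update, polyTensor_update,
    eval_gaussDeriv, polyTensor_eq_mul_prod_erase q i]
  ring

/-- The Hermite polynomials with multi-index `β`, one for each coordinate. -/
noncomputable def hermiteTensor (β : Fin N → ℕ) : Fin N → Polynomial ℝ :=
  fun j => hermitePoly (β j)

theorem update_hermiteTensor (β : Fin N → ℕ) (i : Fin N) (n : ℕ) :
    Function.update (hermiteTensor β) i (hermitePoly n) =
      hermiteTensor (Function.update β i n) :=
  (Function.comp_update hermitePoly β i n).symm

end Tensor

/-! ### Functions of exponential growth and their pairing with `L²(K)` -/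

/-- A continuous function of at most exponential growth. Such functions, divided by `K`, lie in
`L²(K)`; this class contains the test functions and the polynomials. -/
structure HasExpGrowth {E : Type*} [NormedAddCommGroup E] (φ : E → ℝ) : Prop where
  continuous : Continuous φ
  exists_bound : ∃ C a : ℝ, ∀ y, |φ y| ≤ C * Real.exp (a * ‖y‖)

namespace HasExpGrowth

section NormedAddCommGroup

variable {E : Type*} [NormedAddCommGroup E] {φ ψ : E → ℝ}

theorem mul (hφ : HasExpGrowth φ) (hψ : HasExpGrowth ψ) : HasExpGrowth fun y => φ y * ψ y := by
  obtain ⟨C, a, hC⟩ := hφ.exists_bound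
  obtain ⟨D, b, hD⟩ := hψ.exists_bound
  refine ⟨hφ.continuous.mul hψ.continuous, C * D, a + b, fun y => ?_⟩
  rw [abs_mul, add_mul, Real.exp_add, mul_mul_mul_comm]
  exact mul_le_mul (hC y) (hD y) (abs_nonneg _) ((abs_nonneg _).trans (hC y))

theorem add (hφ : HasExpGrowth φ) (hψ : HasExpGrowth ψ) : HasExpGrowth fun y => φ y + ψ y := by
  obtain ⟨C, a, hC⟩ := hφ.exists_bound
  obtain ⟨D, b, hD⟩ := hψ.exists_bound
  have hC0 : 0 ≤ C := by simpa using (abs_nonneg _).trans (hC 0)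
  have hD0 : 0 ≤ D := by simpa using (abs_nonneg _).trans (hD 0)
  refine ⟨hφ.continuous.add hψ.continuous, C + D, max a b, fun y => ?_⟩
  calc |φ y + ψ y| ≤ C * Real.exp (a * ‖y‖) + D * Real.exp (b * ‖y‖) :=
        (abs_add_le _ _).trans (add_le_add (hC y) (hD y))
    _ ≤ C * Real.exp (max a b * ‖y‖) + D * Real.exp (max a b * ‖y‖) := by
        gcongr
        exacts [le_max_left a b, le_max_right a b]
    _ = _ := (add_mul _ _ _).symm

theorem const (c : ℝ) : HasExpGrowth fun _ : E => c :=
  ⟨continuous_const, |c|, 0, fun y => by simp⟩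

theorem const_mul (c : ℝ) (hφ : HasExpGrowth φ) : HasExpGrowth fun y => c * φ y :=
  (const c).mul hφ

theorem neg (hφ : HasExpGrowth φ) : HasExpGrowth fun y => -φ y := by
  simpa using hφ.const_mul (-1)

theorem abs (hφ : HasExpGrowth φ) : HasExpGrowth fun y => |φ y| :=
  ⟨hφ.continuous.abs, by simpa using hφ.exists_bound⟩

theorem pow (hφ : HasExpGrowth φ) (n : ℕ) : HasExpGrowth fun y => φ y ^ n := by
  induction n with
  | zero => simpa using const 1
  | succ n ih => simpa [pow_succ] using ih.mul hφ

theorem sum {ι : Type*} (s : Finset ι) {f : ι → E → ℝ} (h : ∀ i, HasExpGrowth (f i)) :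
    HasExpGrowth fun y => ∑ i ∈ s, f i y := by
  classical
  induction s using Finset.induction_on with
  | empty => simpa using const 0
  | insert i s hi ih => simpa only [Finset.sum_insert hi] using (h i).add ih

theorem prod {ι : Type*} (s : Finset ι) {f : ι → E → ℝ} (h : ∀ i, HasExpGrowth (f i)) :
    HasExpGrowth fun y => ∏ i ∈ s, f i y := by
  classical
  induction s using Finset.induction_on with
  | empty => simpa using const 1
  | insert i s hi ih => simpa only [Finset.prod_insert hi] using (h i).mul ih

theorem of_hasCompactSupport (hc : Continuous φ) (hs : HasCompactSupport φ) : HasExpGrowth φ := by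
  obtain ⟨C, hC⟩ := hs.exists_bound_of_continuous hc
  exact ⟨hc, C, 0, fun y => by simpa using hC y⟩

end NormedAddCommGroup

section InnerProductSpace

variable {E : Type*} [NormedAddCommGroup E] [InnerProductSpace ℝ E] {φ : E → ℝ}

theorem exp_abs_inner (ξ : E) : HasExpGrowth fun y : E => Real.exp |inner ℝ y ξ| := by
  refine ⟨by fun_prop, 1, ‖ξ‖, fun y => ?_⟩
  rw [Real.abs_exp, one_mul, mul_comm]
  exact Real.exp_le_exp.2 (abs_real_inner_le_norm y ξ)

variable [FiniteDimensional ℝ E] [MeasurableSpace E] [BorelSpace E]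

theorem integrable_mul_gauss (hφ : HasExpGrowth φ) {b : ℝ} (hb : 0 < b) :
    Integrable fun y => φ y * Real.exp (-b * ‖y‖ ^ 2) := by
  obtain ⟨C, a, hC⟩ := hφ.exists_bound
  have hC0 : 0 ≤ C := by simpa using (abs_nonneg _).trans (hC 0)
  have hgauss : Integrable fun y : E => Real.exp (-(b / 2) * ‖y‖ ^ 2) := by
    have hb' : 0 < (b / 2 : ℂ).re := by simpa using hb
    refine (GaussianFourier.integrable_cexp_neg_mul_sq_norm_add hb' 0 (0 : E)).norm.congr
      (Eventually.of_forall fun y => ?_)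
    simp [Complex.norm_exp, ← Complex.ofReal_pow]
  refine (hgauss.const_mul (C * Real.exp (a ^ 2 / (2 * b)))).mono'
    (hφ.continuous.mul (by fun_prop)).aestronglyMeasurable (Eventually.of_forall fun y => ?_)
  have hsquare : a * ‖y‖ + -b * ‖y‖ ^ 2 ≤ a ^ 2 / (2 * b) + -(b / 2) * ‖y‖ ^ 2 := by
    have h : a ^ 2 / (2 * b) + -(b / 2) * ‖y‖ ^ 2 - (a * ‖y‖ + -b * ‖y‖ ^ 2) =
        (a - b * ‖y‖) ^ 2 / (2 * b) := by field_simp; ring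
    linarith [show 0 ≤ (a - b * ‖y‖) ^ 2 / (2 * b) by positivity]
  rw [norm_mul, Real.norm_eq_abs, Real.norm_eq_abs, Real.abs_exp]
  calc |φ y| * Real.exp (-b * ‖y‖ ^ 2)
      ≤ C * Real.exp (a * ‖y‖) * Real.exp (-b * ‖y‖ ^ 2) := by gcongr; exact hC y
    _ ≤ C * Real.exp (a ^ 2 / (2 * b) + -(b / 2) * ‖y‖ ^ 2) := by
        rw [mul_assoc, ← Real.exp_add]
        gcongr
    _ = _ := by rw [Real.exp_add, mul_assoc]

end InnerProductSpace

end HasExpGrowth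

section WeightedMeasure

variable {N : ℕ}

theorem weight_pos (N : ℕ) (y : Space N) : 0 < weight N y := Real.exp_pos _

theorem inv_weight (N : ℕ) (y : Space N) : (weight N y)⁻¹ = Real.exp (-(1 / 4) * ‖y‖ ^ 2) := by
  rw [weight, ← Real.exp_neg]
  congr 1
  ring

theorem integral_weightMeasure (g : Space N → ℝ) :
    ∫ y, g y ∂weightMeasure N = ∫ y, weight N y * g y := by
  rw [weightMeasure, integral_withDensity_eq_integral_toReal_smul (measurable_weight N)
    (Eventually.of_forall fun _ => ENNReal.ofReal_lt_top)]
  simp only [ENNReal.toReal_ofReal (weight_pos N _).le, smul_eq_mul]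

theorem integrable_weightMeasure {g : Space N → ℝ} :
    Integrable g (weightMeasure N) ↔ Integrable fun y => weight N y * g y := by
  rw [weightMeasure, integrable_withDensity_iff_integrable_smul' (measurable_weight N)
    (Eventually.of_forall fun _ => ENNReal.ofReal_lt_top)]
  simp only [ENNReal.toReal_ofReal (weight_pos N _).le, smul_eq_mul]

theorem ae_weightMeasure_iff {p : Space N → Prop} : (∀ᵐ y ∂weightMeasure N, p y) ↔ ∀ᵐ y, p y :=
  ⟨fun h => (volume_absolutelyContinuous N).ae_le h,
    fun h => (withDensity_absolutelyContinuous _ _).ae_le h⟩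

end WeightedMeasure

namespace HasExpGrowth

variable {N : ℕ} {φ : Space N → ℝ}

theorem coord (i : Fin N) : HasExpGrowth fun y : Space N => y i := by
  refine ⟨by fun_prop, 1, 1, fun y => ?_⟩
  rw [one_mul, one_mul]
  have h := PiLp.norm_apply_le y i
  rw [Real.norm_eq_abs] at h
  linarith [Real.add_one_le_exp ‖y‖]

theorem polynomial (q : Polynomial ℝ) (i : Fin N) :
    HasExpGrowth fun y : Space N => q.eval (y i) := by
  induction q using Polynomial.induction_on' with
  | add p q hp hq => simpa using hp.add hq
  | monomial n a => simpa using ((coord i).pow n).const_mul a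

theorem polyTensor (q : Fin N → Polynomial ℝ) : HasExpGrowth (polyTensor q) :=
  prod _ fun j => polynomial (q j) j

theorem of_test (h : ContDiff ℝ ∞ φ ∧ HasCompactSupport φ) : HasExpGrowth φ :=
  of_hasCompactSupport h.1.continuous h.2

theorem memLp_div_weight (hφ : HasExpGrowth φ) :
    MemLp (fun y => φ y / weight N y) 2 (weightMeasure N) := by
  have hc : Continuous fun y => φ y / weight N y :=
    hφ.continuous.div (by unfold weight; fun_prop) fun y => (weight_pos N y).ne'
  rw [memLp_two_iff_integrable_sq hc.aestronglyMeasurable, integrable_weightMeasure]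
  refine ((hφ.pow 2).integrable_mul_gauss (b := 1 / 4) (by norm_num)).congr
    (Eventually.of_forall fun y => ?_)
  have := (weight_pos N y).ne'
  simp only [← inv_weight]
  field_simp

/-- The element `φ / K` of `L²(K)`, which represents the functional `v ↦ ∫ v φ dy`. -/
noncomputable def dual (hφ : HasExpGrowth φ) : L2K N := hφ.memLp_div_weight.toLp _

theorem coeFn_dual (hφ : HasExpGrowth φ) : ∀ᵐ y, hφ.dual y = φ y / weight N y :=
  ae_weightMeasure_iff.1 hφ.memLp_div_weight.coeFn_toLp

theorem weight_mul_inner_dual (hφ : HasExpGrowth φ) (v : L2K N) :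
    (fun y => weight N y * inner ℝ (hφ.dual y) (v y)) =ᵐ[volume] fun y => v y * φ y := by
  filter_upwards [hφ.coeFn_dual] with y hy
  rw [hy, RCLike.inner_apply, conj_trivial]
  have := (weight_pos N y).ne'
  field_simp

theorem inner_dual (hφ : HasExpGrowth φ) (v : L2K N) : inner ℝ hφ.dual v = ∫ y, v y * φ y := by
  rw [L2.inner_def, integral_weightMeasure]
  exact integral_congr_ae (hφ.weight_mul_inner_dual v)

theorem integrable_mul (hφ : HasExpGrowth φ) (v : L2K N) : Integrable fun y => v y * φ y :=
  (integrable_weightMeasure.1 (L2.integrable_inner (𝕜 := ℝ) hφ.dual v)).congr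
    (hφ.weight_mul_inner_dual v)

end HasExpGrowth

/-! ### Completeness and orthogonality of the Hermite functions -/

section FourierInjectivity

variable {E : Type*} [NormedAddCommGroup E] [InnerProductSpace ℝ E] [MeasurableSpace E]
  {μ : Measure E} {f : E → ℝ}

theorem charFun_withDensity_ofReal (hf : Integrable f μ) (ξ : E) :
    charFun (μ.withDensity fun y => ENNReal.ofReal (f y)) ξ =
      ∫ y, ((max (f y) 0 : ℝ) : ℂ) * Complex.exp ((inner ℝ y ξ : ℝ) * Complex.I) ∂μ := by
  rw [charFun_apply, integral_withDensity_eq_integral_toReal_smul₀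
    hf.aestronglyMeasurable.aemeasurable.ennreal_ofReal
    (Eventually.of_forall fun _ => ENNReal.ofReal_lt_top)]
  simp only [ENNReal.toReal_ofReal', Complex.real_smul]

variable [BorelSpace E]

theorem integrable_mul_cexp_inner (hf : Integrable f μ) (ξ : E) :
    Integrable (fun y => (f y : ℂ) * Complex.exp ((inner ℝ y ξ : ℝ) * Complex.I)) μ := by
  refine hf.ofReal.mul_bdd (c := 1) ?_ (Eventually.of_forall fun y => ?_)
  · exact (by fun_prop : Continuous fun y : E =>
      Complex.exp ((inner ℝ y ξ : ℝ) * Complex.I)).aestronglyMeasurable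
  · rw [Complex.norm_exp_ofReal_mul_I]

theorem ae_eq_zero_of_integral_mul_cexp_inner [CompleteSpace E] [SecondCountableTopology E]
    (hf : Integrable f μ)
    (h : ∀ ξ, ∫ y, (f y : ℂ) * Complex.exp ((inner ℝ y ξ : ℝ) * Complex.I) ∂μ = 0) :
    f =ᵐ[μ] 0 := by
  have hmeas {g : E → ℝ} (hg : Integrable g μ) : AEMeasurable (fun y => ENNReal.ofReal (g y)) μ :=
    hg.aestronglyMeasurable.aemeasurable.ennreal_ofReal
  have := isFiniteMeasure_withDensity_ofReal hf.2
  have := isFiniteMeasure_withDensity_ofReal hf.neg.2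
  have hparts : (μ.withDensity fun y => ENNReal.ofReal (f y)) =
      μ.withDensity fun y => ENNReal.ofReal ((-f) y) := by
    refine Measure.ext_of_charFun (funext fun ξ => ?_)
    rw [charFun_withDensity_ofReal hf, charFun_withDensity_ofReal hf.neg, ← sub_eq_zero,
      ← integral_sub (integrable_mul_cexp_inner hf.pos_part ξ)
        (integrable_mul_cexp_inner hf.neg.pos_part ξ), ← h ξ]
    simp only [← sub_mul, ← Complex.ofReal_sub, Pi.neg_apply, max_zero_sub_max_neg_zero_eq_self]
  rw [withDensity_eq_iff (hmeas hf) (hmeas hf.neg) hf.lintegral_lt_top.ne] at hparts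
  filter_upwards [hparts] with y hy
  have hmax := congrArg ENNReal.toReal hy
  rw [ENNReal.toReal_ofReal', ENNReal.toReal_ofReal', ← sub_eq_zero] at hmax
  exact (max_zero_sub_max_neg_zero_eq_self (f y)).symm.trans hmax

end FourierInjectivity

theorem integral_mul_cexp_eq_zero_of_moments {α : Type*} [MeasurableSpace α] {μ : Measure α}
    {f g : α → ℝ} (hf : AEStronglyMeasurable f μ) (hg : AEStronglyMeasurable g μ)
    (hfg : Integrable (fun a => f a * Real.exp |g a|) μ) (h : ∀ n, ∫ a, f a * g a ^ n ∂μ = 0) :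
    ∫ a, (f a : ℂ) * Complex.exp (g a * Complex.I) ∂μ = 0 := by
  let F (n : ℕ) (a : α) : ℂ := f a * ((g a * Complex.I) ^ n / n.factorial)
  have hexp (a : α) : HasSum (fun n : ℕ => |f a| * (|g a| ^ n / n.factorial))
      (|f a| * Real.exp |g a|) := by
    rw [Real.exp_eq_exp_ℝ]
    exact (NormedSpace.expSeries_div_hasSum_exp |g a|).mul_left _
  have hcexp (a : α) : HasSum (fun n => F n a) (f a * Complex.exp (g a * Complex.I)) := by
    rw [Complex.exp_eq_exp_ℂ]
    exact (NormedSpace.expSeries_div_hasSum_exp (g a * Complex.I : ℂ)).mul_left _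
  have hsum : HasSum (fun n => ∫ a, F n a ∂μ)
      (∫ a, (f a : ℂ) * Complex.exp (g a * Complex.I) ∂μ) := by
    refine hasSum_integral_of_dominated_convergence
      (fun n a => |f a| * (|g a| ^ n / n.factorial)) (fun n => ?_)
      (fun n => Eventually.of_forall fun a => ?_) (Eventually.of_forall fun a => (hexp a).summable)
      ?_ (Eventually.of_forall fun a => ?_)
    · have hg' := Complex.continuous_ofReal.comp_aestronglyMeasurable hg
      have hf' := Complex.continuous_ofReal.comp_aestronglyMeasurable hf
      exact hf'.mul (((hg'.mul_const Complex.I).pow n).mul_const (n.factorial : ℂ)⁻¹)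
    · simp [F]
    · simpa only [(hexp _).tsum_eq, norm_mul, Real.norm_eq_abs, Real.abs_exp] using hfg.norm
    · exact hcexp a
  refine hsum.unique ?_
  have hF (n : ℕ) : ∫ a, F n a ∂μ = 0 := by
    have hterm (a : α) :
        F n a = Complex.I ^ n / n.factorial * ((f a * g a ^ n : ℝ) : ℂ) := by
      simp only [F]
      push_cast
      ring
    simp only [hterm]
    rw [integral_const_mul, integral_complex_ofReal, h n, Complex.ofReal_zero, mul_zero]
  simpa only [hF] using hasSum_zero

section HermiteBasis

variable {N : ℕ}

/-- The linear span of the products of Hermite polynomials, which is the space of all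
polynomials. -/
noncomputable def hermiteSpan (N : ℕ) : Submodule ℝ (Space N → ℝ) :=
  Submodule.span ℝ (range fun β : Fin N → ℕ => polyTensor (hermiteTensor β))

theorem coord_mul_polyTensor_hermiteTensor (i : Fin N) (β : Fin N → ℕ) (y : Space N) :
    y i * polyTensor (hermiteTensor β) y =
      -2 * polyTensor (hermiteTensor (Function.update β i (β i + 1))) y +
        -(β i : ℝ) * polyTensor (hermiteTensor (Function.update β i (β i - 1))) y := by
  rw [← update_hermiteTensor, ← update_hermiteTensor, polyTensor_update, polyTensor_update,
    polyTensor_eq_mul_prod_erase _ i, hermiteTensor, ← mul_assoc, mul_eval_hermitePoly]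
  ring

theorem coord_mul_mem_hermiteSpan (i : Fin N) {f : Space N → ℝ} (hf : f ∈ hermiteSpan N) :
    (fun y => y i * f y) ∈ hermiteSpan N := by
  induction hf using Submodule.span_induction with
  | mem f hf =>
    obtain ⟨β, rfl⟩ := hf
    rw [funext (coord_mul_polyTensor_hermiteTensor i β)]
    exact add_mem (Submodule.smul_mem _ _ (Submodule.subset_span ⟨_, rfl⟩))
      (Submodule.smul_mem _ _ (Submodule.subset_span ⟨_, rfl⟩))
  | zero => simpa only [Pi.zero_apply, mul_zero] using! (hermiteSpan N).zero_mem
  | add f g _ _ hf hg => simpa only [Pi.add_apply, mul_add] using! add_mem hf hg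
  | smul c f _ hf =>
    simpa only [Pi.smul_apply, smul_eq_mul, mul_left_comm _ c] using! Submodule.smul_mem _ c hf

theorem inner_pow_mem_hermiteSpan (ξ : Space N) (n : ℕ) :
    (fun y : Space N => (inner ℝ y ξ : ℝ) ^ n) ∈ hermiteSpan N := by
  induction n with
  | zero =>
    refine Submodule.subset_span ⟨0, funext fun y => ?_⟩
    simp [polyTensor, hermiteTensor, hermitePoly]
  | succ n ih =>
    have hsum : (fun y : Space N => (inner ℝ y ξ : ℝ) ^ (n + 1)) =
        ∑ i, ξ i • fun y : Space N => y i * (inner ℝ y ξ : ℝ) ^ n := by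
      funext y
      have hinner : (inner ℝ y ξ : ℝ) = ∑ i, ξ i * y i := by simp [PiLp.inner_apply]
      simp only [Finset.sum_apply, Pi.smul_apply, smul_eq_mul, ← mul_assoc, ← Finset.sum_mul]
      rw [pow_succ', ← hinner]
    rw [hsum]
    exact sum_mem fun i _ => Submodule.smul_mem _ _ (coord_mul_mem_hermiteSpan i ih)

theorem integral_mul_hermiteSpan {v : L2K N}
    (h : ∀ β : Fin N → ℕ, ∫ y, v y * polyTensor (hermiteTensor β) y = 0) {f : Space N → ℝ}
    (hf : f ∈ hermiteSpan N) : Integrable (fun y => v y * f y) ∧ ∫ y, v y * f y = 0 := by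
  induction hf using Submodule.span_induction with
  | mem f hf =>
    obtain ⟨β, rfl⟩ := hf
    exact ⟨(HasExpGrowth.polyTensor _).integrable_mul v, h β⟩
  | zero => simp
  | add f g _ _ hf hg =>
    simp only [Pi.add_apply, mul_add]
    exact ⟨hf.1.add hg.1, by rw [integral_add hf.1 hg.1, hf.2, hg.2, add_zero]⟩
  | smul c f _ hf =>
    simp only [Pi.smul_apply, smul_eq_mul, mul_left_comm _ c]
    exact ⟨hf.1.const_mul c, by rw [integral_const_mul, hf.2, mul_zero]⟩

theorem eq_zero_of_integral_mul_hermiteTensor {v : L2K N}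
    (h : ∀ β : Fin N → ℕ, ∫ y, v y * polyTensor (hermiteTensor β) y = 0) : v = 0 := by
  have hv : Integrable (v : Space N → ℝ) := by
    simpa using (HasExpGrowth.const (E := Space N) 1).integrable_mul v
  have hmoments (ξ : Space N) (n : ℕ) : ∫ y, v y * (inner ℝ y ξ : ℝ) ^ n = 0 :=
    (integral_mul_hermiteSpan h (inner_pow_mem_hermiteSpan ξ n)).2
  rw [Lp.eq_zero_iff_ae_eq_zero]
  refine ae_weightMeasure_iff.2 (ae_eq_zero_of_integral_mul_cexp_inner hv fun ξ => ?_)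
  exact integral_mul_cexp_eq_zero_of_moments hv.aestronglyMeasurable
    (by fun_prop : Continuous fun y : Space N => (inner ℝ y ξ : ℝ)).aestronglyMeasurable
    ((HasExpGrowth.exp_abs_inner ξ).integrable_mul v) (hmoments ξ)

theorem gaussTensor_eq_div_weight (q : Fin N → Polynomial ℝ) (y : Space N) :
    gaussTensor q y = (4 * Real.pi) ^ (-(N : ℝ) / 4) * polyTensor q y / weight N y := by
  rw [gaussTensor, phiOneFun, weight, neg_div (4 : ℝ) (‖y‖ ^ 2), Real.exp_neg]
  ring

/-- The class of `gaussTensor q` in `L²(K)`. -/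
noncomputable def gaussL2 (q : Fin N → Polynomial ℝ) : L2K N :=
  ((HasExpGrowth.polyTensor q).const_mul ((4 * Real.pi) ^ (-(N : ℝ) / 4))).dual

theorem coeFn_gaussL2 (q : Fin N → Polynomial ℝ) : ∀ᵐ y, gaussL2 q y = gaussTensor q y := by
  simp only [gaussTensor_eq_div_weight]
  exact ((HasExpGrowth.polyTensor q).const_mul _).coeFn_dual

theorem inner_gaussL2 (q : Fin N → Polynomial ℝ) (v : L2K N) :
    inner ℝ (gaussL2 q) v = (4 * Real.pi) ^ (-(N : ℝ) / 4) * ∫ y, v y * polyTensor q y := by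
  simp only [gaussL2, HasExpGrowth.inner_dual, ← integral_const_mul, mul_left_comm]

theorem integral_polyTensor_mul_polyTensor_div_weight (p q : Fin N → Polynomial ℝ) :
    ∫ y : Space N, polyTensor p y * polyTensor q y / weight N y =
      ∏ j, gaussInner (p j) (q j) := by
  simp only [gaussInner]
  rw [← integral_fintype_prod_volume_eq_prod (f := fun j (x : ℝ) =>
    (p j).eval x * (q j).eval x * Real.exp (-(1 / 4) * x ^ 2)),
    ← (EuclideanSpace.volume_preserving_symm_measurableEquiv_toLp (Fin N)).integral_comp
      (MeasurableEquiv.measurableEmbedding _)]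
  congr 1 with y
  rw [Finset.prod_mul_distrib, Finset.prod_mul_distrib, ← Real.exp_sum, ← Finset.mul_sum,
    div_eq_mul_inv, inv_weight, EuclideanSpace.norm_sq_eq]
  simp [polyTensor]

/-- The squared norm `∏ j, β_j! / 2^{β_j}` of the derivative `D^β φ₁` in `L²(K)`. -/
noncomputable def hermiteNormSq (β : Fin N → ℕ) : ℝ :=
  ∏ j, ((β j).factorial : ℝ) / 2 ^ β j

theorem hermiteNormSq_pos (β : Fin N → ℕ) : 0 < hermiteNormSq β :=
  Finset.prod_pos fun _ _ => by positivity

theorem prod_gaussInner_hermiteTensor (β γ : Fin N → ℕ) :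
    ∏ j, gaussInner (hermiteTensor β j) (hermiteTensor γ j) =
      if β = γ then hermiteNormSq β * √(4 * Real.pi) ^ N else 0 := by
  simp only [hermiteTensor, gaussInner_hermitePoly]
  split_ifs with h
  · simp [h, hermiteNormSq, Finset.prod_mul_distrib]
  · obtain ⟨j, hj⟩ := Function.ne_iff.1 h
    exact Finset.prod_eq_zero (Finset.mem_univ j) (if_neg hj)

theorem inner_gaussL2_hermiteTensor (β γ : Fin N → ℕ) :
    inner ℝ (gaussL2 (hermiteTensor β)) (gaussL2 (hermiteTensor γ)) =
      if β = γ then hermiteNormSq β else 0 := by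
  set c : ℝ := (4 * Real.pi) ^ (-(N : ℝ) / 4) with hc
  have hnormalise : c * c * √(4 * Real.pi) ^ N = 1 := by
    have hpi : (0 : ℝ) < 4 * Real.pi := by positivity
    rw [hc, Real.sqrt_eq_rpow, ← Real.rpow_natCast, ← Real.rpow_mul hpi.le, ← Real.rpow_add hpi,
      ← Real.rpow_add hpi]
    ring_nf
    exact Real.rpow_zero _
  have hpairing : ∫ y, gaussL2 (hermiteTensor γ) y * polyTensor (hermiteTensor β) y =
      c * ∏ j, gaussInner (hermiteTensor β j) (hermiteTensor γ j) := by
    rw [← integral_polyTensor_mul_polyTensor_div_weight, ← integral_const_mul]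
    refine integral_congr_ae ?_
    filter_upwards [coeFn_gaussL2 (hermiteTensor γ)] with y hy
    rw [hy, gaussTensor_eq_div_weight]
    ring
  rw [inner_gaussL2, hpairing, prod_gaussInner_hermiteTensor]
  split_ifs with h
  · linear_combination hermiteNormSq β * hnormalise
  · simp only [mul_zero]

/-- The normalised Hermite functions `D^β φ₁ / ‖D^β φ₁‖_K`. -/
noncomputable def hermiteE (β : Fin N → ℕ) : L2K N :=
  (√(hermiteNormSq β))⁻¹ • gaussL2 (hermiteTensor β)

theorem gaussL2_hermiteTensor (β : Fin N → ℕ) :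
    gaussL2 (hermiteTensor β) = √(hermiteNormSq β) • hermiteE β := by
  rw [hermiteE, smul_smul, mul_inv_cancel₀ (Real.sqrt_pos.2 (hermiteNormSq_pos β)).ne', one_smul]

theorem orthonormal_hermiteE (N : ℕ) : Orthonormal ℝ (hermiteE (N := N)) := by
  classical
  rw [orthonormal_iff_ite]
  intro β γ
  rw [hermiteE, hermiteE, real_inner_smul_left, real_inner_smul_right, inner_gaussL2_hermiteTensor]
  split_ifs with h
  · rw [← h, ← mul_assoc, ← mul_inv, Real.mul_self_sqrt (hermiteNormSq_pos β).le,
      inv_mul_cancel₀ (hermiteNormSq_pos β).ne']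
  · simp only [mul_zero]

/-- The Hilbert basis of `L²(K)` formed by the normalised Hermite functions. -/
noncomputable def hermiteBasis (N : ℕ) : HilbertBasis (Fin N → ℕ) ℝ (L2K N) :=
  HilbertBasis.mkOfOrthogonalEqBot (orthonormal_hermiteE N) <| by
    rw [Submodule.eq_bot_iff]
    intro v hv
    refine eq_zero_of_integral_mul_hermiteTensor fun β => ?_
    have horthogonal : inner ℝ (gaussL2 (hermiteTensor β)) v = 0 := by
      rw [gaussL2_hermiteTensor, real_inner_smul_left,
        (Submodule.mem_orthogonal _ _).1 hv _ (Submodule.subset_span ⟨β, rfl⟩), mul_zero]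
    rw [inner_gaussL2] at horthogonal
    exact (mul_eq_zero.1 horthogonal).resolve_left (by positivity)

theorem hermiteBasis_apply (β : Fin N → ℕ) : hermiteBasis N β = hermiteE β := by
  rw [hermiteBasis, HilbertBasis.coe_mkOfOrthogonalEqBot]

theorem hermiteE_zero (N : ℕ) : hermiteE (0 : Fin N → ℕ) = phiOne N := by
  refine Lp.ext (ae_weightMeasure_iff.2 ?_)
  filter_upwards [coeFn_gaussL2 (hermiteTensor (0 : Fin N → ℕ)),
    ae_weightMeasure_iff.1 (memLp_phiOneFun N).coeFn_toLp] with y hgauss hphi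
  simp [hermiteE, hermiteNormSq, phiOne, hphi, hgauss, gaussTensor, polyTensor, hermiteTensor,
    hermitePoly]

end HermiteBasis

/-! ### Weak derivatives of the Hermite functions -/

section WeakDerivative

variable {N : ℕ}

theorem foldr_iterate_partialD_single (i : Fin N) (k : ℕ) (φ : Space N → ℝ) {l : List (Fin N)}
    (hl : l.Nodup) :
    l.foldr (fun j ψ => (partialD j)^[(Pi.single i k : Fin N → ℕ) j] ψ) φ =
      if i ∈ l then (partialD i)^[k] φ else φ := by
  induction l with
  | nil => simp
  | cons j l ih =>
    rw [List.nodup_cons] at hl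
    rw [List.foldr_cons, ih hl.2]
    by_cases h : j = i
    · subst h
      simp [hl.1]
    · simp [Ne.symm h]

theorem multiD_single (i : Fin N) (k : ℕ) (φ : Space N → ℝ) :
    multiD (Pi.single i k) φ = (partialD i)^[k] φ := by
  rw [multiD, foldr_iterate_partialD_single i k φ (List.nodup_finRange N),
    if_pos (List.mem_finRange i)]

theorem HasWeakDeriv.integral_mul_iterate_partialD {i : Fin N} {k : ℕ} {v w : L2K N}
    (h : HasWeakDeriv (Pi.single i k) v w) {φ : Space N → ℝ}
    (hφ : ContDiff ℝ ∞ φ ∧ HasCompactSupport φ) :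
    ∫ y, v y * (partialD i)^[k] φ y = (-1) ^ k * ∫ y, w y * φ y := by
  rw [← multiD_single, h φ hφ.1 hφ.2, Finset.sum_pi_single', if_pos (Finset.mem_univ i)]

theorem iterate_partialD_smooth (i : Fin N) (k : ℕ) {φ : Space N → ℝ}
    (h : ContDiff ℝ ∞ φ ∧ HasCompactSupport φ) :
    ContDiff ℝ ∞ ((partialD i)^[k] φ) ∧ HasCompactSupport ((partialD i)^[k] φ) := by
  rw [← multiD_single]
  exact multiD_smooth _ h

theorem foldr_iterate_partialD_smooth (α : Fin N → ℕ) (l : List (Fin N)) {φ : Space N → ℝ}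
    (h : ContDiff ℝ ∞ φ ∧ HasCompactSupport φ) :
    ContDiff ℝ ∞ (l.foldr (fun i ψ => (partialD i)^[α i] ψ) φ) ∧
      HasCompactSupport (l.foldr (fun i ψ => (partialD i)^[α i] ψ) φ) := by
  induction l with
  | nil => exact h
  | cons i l ih => exact iterate_partialD_smooth i _ ih

theorem integral_mul_partialD (i : Fin N) {f φ : Space N → ℝ} (hf : ContDiff ℝ ∞ f)
    (hφ : ContDiff ℝ ∞ φ ∧ HasCompactSupport φ) :
    ∫ y, f y * partialD i φ y = -∫ y, partialD i f y * φ y := by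
  have integrable_mul {a b : Space N → ℝ} (ha : ContDiff ℝ ∞ a)
      (hb : ContDiff ℝ ∞ b ∧ HasCompactSupport b) : Integrable fun y => a y * b y :=
    (ha.continuous.mul hb.1.continuous).integrable_of_hasCompactSupport hb.2.mul_left
  exact integral_mul_fderiv_eq_neg_fderiv_mul_of_integrable
    (integrable_mul (contDiff_partialD i hf) hφ) (integrable_mul hf (partialD_smooth i hφ))
    (integrable_mul hf hφ) (fun y _ => hf.differentiable (by simp) y)
    (fun y _ => hφ.1.differentiable (by simp) y)

theorem add_single_eq_update (β : Fin N → ℕ) (i : Fin N) (k : ℕ) :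
    β + Pi.single i k = Function.update β i (β i + k) := by
  funext j
  by_cases h : j = i
  · subst h
    simp
  · simp [h]

theorem partialD_gaussTensor_hermiteTensor (i : Fin N) (β : Fin N → ℕ) :
    partialD i (gaussTensor (hermiteTensor β)) =
      gaussTensor (hermiteTensor (β + Pi.single i 1)) := by
  rw [partialD_gaussTensor, add_single_eq_update, ← update_hermiteTensor]
  rfl

theorem integral_gaussTensor_mul_iterate_partialD (i : Fin N) (k : ℕ) (β : Fin N → ℕ)
    {φ : Space N → ℝ} (h : ContDiff ℝ ∞ φ ∧ HasCompactSupport φ) :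
    ∫ y, gaussTensor (hermiteTensor β) y * (partialD i)^[k] φ y =
      (-1) ^ k * ∫ y, gaussTensor (hermiteTensor (β + Pi.single i k)) y * φ y := by
  induction k generalizing φ with
  | zero => simp
  | succ k ih =>
    rw [Function.iterate_succ_apply, ih (partialD_smooth i h),
      integral_mul_partialD i (contDiff_gaussTensor _) h, partialD_gaussTensor_hermiteTensor,
      add_assoc, ← Pi.single_add, pow_succ]
    ring

theorem integral_gaussTensor_mul_foldr (α : Fin N → ℕ) (l : List (Fin N)) (β : Fin N → ℕ)
    {φ : Space N → ℝ} (h : ContDiff ℝ ∞ φ ∧ HasCompactSupport φ) :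
    ∫ y, gaussTensor (hermiteTensor β) y * l.foldr (fun i ψ => (partialD i)^[α i] ψ) φ y =
      (-1) ^ (l.map α).sum * ∫ y, gaussTensor
        (hermiteTensor (β + (l.map fun i => Pi.single i (α i)).sum)) y * φ y := by
  induction l generalizing β with
  | nil => simp
  | cons i l ih =>
    simp only [List.foldr_cons, List.map_cons, List.sum_cons]
    rw [integral_gaussTensor_mul_iterate_partialD i _ _ (foldr_iterate_partialD_smooth α l h), ih,
      pow_add, add_assoc, mul_assoc]

theorem hasWeakDeriv_gaussL2 (α β : Fin N → ℕ) :
    HasWeakDeriv α (gaussL2 (hermiteTensor β)) (gaussL2 (hermiteTensor (β + α))) := by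
  intro φ hφ hsupp
  have coeFn (γ : Fin N → ℕ) (ψ : Space N → ℝ) : ∫ y, gaussL2 (hermiteTensor γ) y * ψ y =
      ∫ y, gaussTensor (hermiteTensor γ) y * ψ y := by
    refine integral_congr_ae ?_
    filter_upwards [coeFn_gaussL2 (hermiteTensor γ)] with y hy
    rw [hy]
  rw [coeFn, coeFn, multiD, integral_gaussTensor_mul_foldr α _ β ⟨hφ, hsupp⟩,
    ← List.ofFn_eq_map, ← List.ofFn_eq_map, List.sum_ofFn, List.sum_ofFn,
    Finset.univ_sum_single]

/-- The factor `κ` in `D^α e_β = κ e_{β + α}`, where `e_β` is the normalised Hermite function. -/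
noncomputable def shiftFactor (α β : Fin N → ℕ) : ℝ :=
  √(hermiteNormSq (β + α)) / √(hermiteNormSq β)

theorem hasWeakDeriv_hermiteE (α β : Fin N → ℕ) :
    HasWeakDeriv α (hermiteE β) (shiftFactor α β • hermiteE (β + α)) := by
  have h := (hasWeakDeriv_gaussL2 α β).smul (√(hermiteNormSq β))⁻¹
  rw [gaussL2_hermiteTensor (β + α), smul_smul] at h
  rwa [shiftFactor, div_eq_inv_mul, hermiteE]

theorem hasWeakDeriv_iff {α : Fin N → ℕ} {v w : L2K N} :
    HasWeakDeriv α v w ↔ ∀ (φ : Space N → ℝ) (h : ContDiff ℝ ∞ φ ∧ HasCompactSupport φ),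
      inner ℝ (HasExpGrowth.of_test (multiD_smooth α h)).dual v =
        (-1 : ℝ) ^ (∑ i, α i) * inner ℝ (HasExpGrowth.of_test h).dual w := by
  simp only [HasExpGrowth.inner_dual]
  exact ⟨fun h φ hφ => h φ hφ.1 hφ.2, fun h φ hφ hsupp => h φ ⟨hφ, hsupp⟩⟩

theorem HasWeakDeriv.of_hasSum {α : Fin N → ℕ} {ι : Type*} {v w : ι → L2K N} {v₀ w₀ : L2K N}
    (h : ∀ n, HasWeakDeriv α (v n) (w n)) (hv : HasSum v v₀) (hw : HasSum w w₀) :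
    HasWeakDeriv α v₀ w₀ := by
  rw [hasWeakDeriv_iff]
  intro φ hφ
  have hv' := hv.mapL (innerSL ℝ (HasExpGrowth.of_test (multiD_smooth α hφ)).dual)
  have hw' := (hw.mapL (innerSL ℝ (HasExpGrowth.of_test hφ).dual)).mul_left
    ((-1 : ℝ) ^ ∑ i, α i)
  simp only [innerSL_apply_apply, fun n => hasWeakDeriv_iff.1 (h n) φ hφ] at hv' hw'
  exact hv'.unique hw'

end WeakDerivative

/-! ### The operator `L` in the sense of distributions -/

section AdjointL

variable {N : ℕ}

/-- The formal adjoint `φ ↦ -Δ φ + div (y φ) / 2` of `L` with respect to `dy`. -/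
noncomputable def adjointL (φ : Space N → ℝ) (y : Space N) : ℝ :=
  -(Δ φ) y + (N * φ y + fderiv ℝ φ y y) / 2

theorem laplacian_eq_sum_partialD {φ : Space N → ℝ} (h : ContDiff ℝ ∞ φ) (y : Space N) :
    (Δ φ) y = ∑ i, partialD i (partialD i φ) y := by
  rw [InnerProductSpace.laplacian_eq_iteratedFDeriv_orthonormalBasis φ
    (EuclideanSpace.basisFun (Fin N) ℝ)]
  refine Finset.sum_congr rfl fun i _ => ?_
  have hd : DifferentiableAt ℝ (fderiv ℝ φ) y :=
    (h.fderiv_right (m := ∞) (by simp)).differentiable (by simp) y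
  have hpartial := (hd.hasFDerivAt.clm_apply
    (hasFDerivAt_const (EuclideanSpace.single i (1 : ℝ)) y)).fderiv
  rw [iteratedFDeriv_two_apply, partialD,
    show partialD i φ = fun y => fderiv ℝ φ y (EuclideanSpace.single i 1) from rfl, hpartial]
  simp

theorem adjointL_eq_sum {φ : Space N → ℝ} (h : ContDiff ℝ ∞ φ) (y : Space N) :
    adjointL φ y = ∑ i, (-partialD i (partialD i φ) y + (φ y + y i * partialD i φ y) / 2) := by
  rw [adjointL, laplacian_eq_sum_partialD h, fderiv_apply_eq_sum, Finset.sum_add_distrib,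
    ← Finset.sum_div, Finset.sum_add_distrib, Finset.sum_neg_distrib]
  simp

theorem HasExpGrowth.adjointL_of_test {φ : Space N → ℝ}
    (h : ContDiff ℝ ∞ φ ∧ HasCompactSupport φ) : HasExpGrowth (adjointL φ) := by
  have hterm (i : Fin N) := (of_test (partialD_smooth i (partialD_smooth i h))).neg.add
    (((of_test h).add ((coord i).mul (of_test (partialD_smooth i h)))).const_mul 2⁻¹)
  convert sum Finset.univ hterm using 2 with y
  simp only [adjointL_eq_sum h.1, div_eq_inv_mul]

/-- `L u = f` in the sense of distributions. -/
def WeakL (u f : L2K N) : Prop :=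
  ∀ φ : Space N → ℝ, ContDiff ℝ ∞ φ → HasCompactSupport φ →
    ∫ y, u y * adjointL φ y = ∫ y, f y * φ y

theorem weakL_iff {u f : L2K N} :
    WeakL u f ↔ ∀ (φ : Space N → ℝ) (h : ContDiff ℝ ∞ φ ∧ HasCompactSupport φ),
      inner ℝ (HasExpGrowth.adjointL_of_test h).dual u =
        inner ℝ (HasExpGrowth.of_test h).dual f := by
  simp only [HasExpGrowth.inner_dual]
  exact ⟨fun h φ hφ => h φ hφ.1 hφ.2, fun h φ hφ hsupp => h φ ⟨hφ, hsupp⟩⟩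

theorem WeakL.smul {u f : L2K N} (c : ℝ) (h : WeakL u f) : WeakL (c • u) (c • f) := by
  rw [weakL_iff] at *
  intro φ hφ
  rw [real_inner_smul_right, real_inner_smul_right, h φ hφ]

theorem WeakL.of_hasSum {ι : Type*} {u f : ι → L2K N} {u₀ f₀ : L2K N}
    (h : ∀ n, WeakL (u n) (f n)) (hu : HasSum u u₀) (hf : HasSum f f₀) : WeakL u₀ f₀ := by
  rw [weakL_iff]
  intro φ hφ
  have hu' := hu.mapL (innerSL ℝ (HasExpGrowth.adjointL_of_test hφ).dual)
  have hf' := hf.mapL (innerSL ℝ (HasExpGrowth.of_test hφ).dual)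
  simp only [innerSL_apply_apply, fun n => weakL_iff.1 (h n) φ hφ] at hu' hf'
  exact hu'.unique hf'

theorem coord_mul_smooth (i : Fin N) {φ : Space N → ℝ}
    (h : ContDiff ℝ ∞ φ ∧ HasCompactSupport φ) :
    ContDiff ℝ ∞ (fun y : Space N => y i * φ y) ∧ HasCompactSupport fun y : Space N => y i * φ y :=
  ⟨(contDiff_piLp_apply (p := 2)).mul h.1, h.2.mul_left⟩

theorem partialD_coord_mul (i : Fin N) {φ : Space N → ℝ} (h : ContDiff ℝ ∞ φ) (y : Space N) :
    partialD i (fun y => y i * φ y) y = φ y + y i * partialD i φ y := by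
  have hcoord : partialD i (fun y : Space N => y i) y = 1 := by
    rw [partialD,
      show (fun y : Space N => y i) = (EuclideanSpace.proj i : Space N →L[ℝ] ℝ) from rfl,
      ContinuousLinearMap.fderiv]
    simp
  rw [partialD_mul i (by fun_prop) (h.differentiable (by simp) y), hcoord, one_mul]

theorem integral_mul_adjointL_coord {i : Fin N} {u g h : L2K N}
    (hg : HasWeakDeriv (Pi.single i 1) u g) (hh : HasWeakDeriv (Pi.single i 2) u h)
    {φ : Space N → ℝ} (hφ : ContDiff ℝ ∞ φ ∧ HasCompactSupport φ) :
    ∫ y, u y * (-partialD i (partialD i φ) y + (φ y + y i * partialD i φ y) / 2) =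
      ∫ y, (-h y - y i * g y / 2) * φ y := by
  have hyφ := coord_mul_smooth i hφ
  have integrable {v : L2K N} {ψ : Space N → ℝ} (hψ : ContDiff ℝ ∞ ψ ∧ HasCompactSupport ψ) :
      Integrable fun y => v y * ψ y := integrable_mul_test v hψ.1 hψ.2
  have hfirst : ∫ y, u y * partialD i (fun y => y i * φ y) y = -∫ y, g y * (y i * φ y) := by
    simpa using hg.integral_mul_iterate_partialD hyφ
  have hsecond : ∫ y, u y * partialD i (partialD i φ) y = ∫ y, h y * φ y := by
    simpa using hh.integral_mul_iterate_partialD hφ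
  calc ∫ y, u y * (-partialD i (partialD i φ) y + (φ y + y i * partialD i φ y) / 2)
      = ∫ y, (u y * partialD i (fun y => y i * φ y) y / 2 -
          u y * partialD i (partialD i φ) y) := by
        refine integral_congr_ae (Eventually.of_forall fun y => ?_)
        simp only [partialD_coord_mul i hφ.1]
        ring
    _ = ∫ y, (-1 / 2 * (g y * (y i * φ y)) - h y * φ y) := by
        rw [integral_sub ((integrable (partialD_smooth i hyφ)).div_const 2)
          (integrable (partialD_smooth i (partialD_smooth i hφ))), integral_div, hfirst, hsecond,
          integral_sub ((integrable hyφ).const_mul _) (integrable hφ), integral_const_mul]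
        ring
    _ = ∫ y, (-h y - y i * g y / 2) * φ y := by
        congr with y
        ring

theorem integral_mul_adjointL {u : L2K N} {g h : Fin N → L2K N}
    (hg : ∀ i, HasWeakDeriv (Pi.single i 1) u (g i))
    (hh : ∀ i, HasWeakDeriv (Pi.single i 2) u (h i)) {φ : Space N → ℝ}
    (hφ : ContDiff ℝ ∞ φ ∧ HasCompactSupport φ) :
    ∫ y, u y * adjointL φ y = ∫ y, (-(∑ i, h i y) - (∑ i, y i * g i y) / 2) * φ y := by
  have hleft (i : Fin N) : Integrable fun y =>
      u y * (-partialD i (partialD i φ) y + (φ y + y i * partialD i φ y) / 2) := by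
    have hterm := (HasExpGrowth.of_test (partialD_smooth i (partialD_smooth i hφ))).neg.add
      (((HasExpGrowth.of_test hφ).add ((HasExpGrowth.coord i).mul
        (.of_test (partialD_smooth i hφ)))).const_mul 2⁻¹)
    simpa only [div_eq_inv_mul] using hterm.integrable_mul u
  have hright (i : Fin N) : Integrable fun y => (-h i y - y i * g i y / 2) * φ y := by
    have hyφ := coord_mul_smooth i hφ
    refine ((integrable_mul_test (h i) hφ.1 hφ.2).neg.sub
      ((integrable_mul_test (g i) hyφ.1 hyφ.2).div_const 2)).congr
      (Eventually.of_forall fun y => ?_)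
    simp only [Pi.sub_apply, Pi.neg_apply]
    ring
  calc ∫ y, u y * adjointL φ y
      = ∑ i, ∫ y, u y * (-partialD i (partialD i φ) y + (φ y + y i * partialD i φ y) / 2) := by
        simp only [adjointL_eq_sum hφ.1, Finset.mul_sum]
        exact integral_finsetSum _ fun i _ => hleft i
    _ = ∑ i, ∫ y, (-h i y - y i * g i y / 2) * φ y :=
        Finset.sum_congr rfl fun i _ => integral_mul_adjointL_coord (hg i) (hh i) hφ
    _ = ∫ y, (-(∑ i, h i y) - (∑ i, y i * g i y) / 2) * φ y := by
        rw [← integral_finsetSum _ fun i _ => hright i]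
        simp only [← Finset.sum_mul, Finset.sum_sub_distrib, Finset.sum_neg_distrib,
          ← Finset.sum_div]

theorem IsL.weakL {u f : L2K N} (h : IsL u f) : WeakL u f := by
  obtain ⟨-, g, k, hg, hk, hf⟩ := h
  intro φ hφ hsupp
  rw [integral_mul_adjointL hg hk ⟨hφ, hsupp⟩]
  refine integral_congr_ae ?_
  filter_upwards [hf] with y hy
  rw [hy]

theorem WeakL.ae_eq {u f : L2K N} (hu : WeakL u f) {g h : Fin N → L2K N}
    (hg : ∀ i, HasWeakDeriv (Pi.single i 1) u (g i))
    (hh : ∀ i, HasWeakDeriv (Pi.single i 2) u (h i)) :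
    ∀ᵐ y, f y = -(∑ i, h i y) - (∑ i, y i * g i y) / 2 := by
  have hf : Integrable f := by
    simpa using (HasExpGrowth.const (E := Space N) 1).integrable_mul f
  have hrhs : Integrable fun y => -(∑ i, h i y) - (∑ i, y i * g i y) / 2 := by
    refine (integrable_finsetSum _ fun i _ => ?_).neg.sub
      ((integrable_finsetSum _ fun i _ => ?_).div_const 2)
    · simpa using (HasExpGrowth.const (E := Space N) 1).integrable_mul (h i)
    · simpa only [mul_comm] using (HasExpGrowth.coord i).integrable_mul (g i)
  refine ae_eq_of_integral_contDiff_smul_eq hf.locallyIntegrable hrhs.locallyIntegrable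
    fun φ hφ hsupp => ?_
  simp only [smul_eq_mul, mul_comm (φ _)]
  rw [← integral_mul_adjointL hg hh ⟨hφ, hsupp⟩, hu φ hφ hsupp]

end AdjointL

/-! ### The Hermite functions as eigenfunctions -/

section Eigenfunctions

variable {N : ℕ}

/-- The eigenvalue `|β| / 2` of `L - N / 2` on the Hermite function of index `β`. -/
noncomputable def eigenvalue (β : Fin N → ℕ) : ℝ := (∑ i, (β i : ℝ)) / 2

theorem eigenvalue_nonneg (β : Fin N → ℕ) : 0 ≤ eigenvalue β := by
  unfold eigenvalue
  positivity

theorem sum_add_one_div_two (β : Fin N → ℕ) :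
    ∑ i, ((β i : ℝ) + 1) / 2 = eigenvalue β + (N : ℝ) / 2 := by
  rw [← Finset.sum_div, Finset.sum_add_distrib, eigenvalue]
  simp [add_div]

theorem gaussTensor_hermiteTensor_coord (β : Fin N → ℕ) (i : Fin N) (y : Space N) :
    -gaussTensor (hermiteTensor (β + Pi.single i 2)) y -
        y i * gaussTensor (hermiteTensor (β + Pi.single i 1)) y / 2 =
      ((β i : ℝ) + 1) / 2 * gaussTensor (hermiteTensor β) y := by
  have hrec := mul_eval_hermitePoly (β i + 1) (y i)
  simp only [Nat.add_sub_cancel, Nat.cast_add, Nat.cast_one] at hrec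
  rw [add_single_eq_update, add_single_eq_update, ← update_hermiteTensor, ← update_hermiteTensor,
    gaussTensor, gaussTensor, gaussTensor, polyTensor_update, polyTensor_update,
    polyTensor_eq_mul_prod_erase _ i, show hermiteTensor β i = hermitePoly (β i) from rfl]
  linear_combination (-1 / 2) * (∏ j ∈ Finset.univ.erase i, (hermiteTensor β j).eval (y j)) *
    phiOneFun N y * hrec

theorem weakL_gaussL2 (β : Fin N → ℕ) :
    WeakL (gaussL2 (hermiteTensor β))
      ((eigenvalue β + (N : ℝ) / 2) • gaussL2 (hermiteTensor β)) := by
  intro φ hφ hsupp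
  rw [integral_mul_adjointL (fun i => hasWeakDeriv_gaussL2 (Pi.single i 1) β)
    (fun i => hasWeakDeriv_gaussL2 (Pi.single i 2) β) ⟨hφ, hsupp⟩]
  refine integral_congr_ae ?_
  filter_upwards [ae_all_iff.2 fun γ : Fin N → ℕ => coeFn_gaussL2 (hermiteTensor γ),
    ae_weightMeasure_iff.1 (Lp.coeFn_smul (eigenvalue β + (N : ℝ) / 2)
      (gaussL2 (hermiteTensor β)))] with y hgauss hsmul
  rw [hsmul, Pi.smul_apply, smul_eq_mul]
  simp only [hgauss]
  rw [← sum_add_one_div_two, Finset.sum_mul,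
    ← Finset.sum_congr rfl fun i _ => gaussTensor_hermiteTensor_coord β i y,
    Finset.sum_sub_distrib, Finset.sum_neg_distrib, Finset.sum_div]

theorem weakL_hermiteE (β : Fin N → ℕ) :
    WeakL (hermiteE β) ((eigenvalue β + (N : ℝ) / 2) • hermiteE β) := by
  have h := (weakL_gaussL2 β).smul (√(hermiteNormSq β))⁻¹
  rwa [smul_comm] at h

theorem adjointL_polyTensor (β : Fin N → ℕ) (y : Space N) :
    adjointL (polyTensor (hermiteTensor β)) y =
      (eigenvalue β + (N : ℝ) / 2) * polyTensor (hermiteTensor β) y := by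
  rw [adjointL_eq_sum (contDiff_polyTensor _), ← sum_add_one_div_two, Finset.sum_mul]
  refine Finset.sum_congr rfl fun i _ => ?_
  have hode := congrArg (Polynomial.eval (y i)) (gaussDeriv_derivative_hermitePoly (β i))
  rw [eval_gaussDeriv, Polynomial.eval_mul, Polynomial.eval_C] at hode
  rw [partialD_polyTensor, partialD_polyTensor, Function.update_idem, Function.update_self,
    polyTensor_update, polyTensor_update, polyTensor_eq_mul_prod_erase _ i,
    show hermiteTensor β i = hermitePoly (β i) from rfl]
  linear_combination -(∏ j ∈ Finset.univ.erase i, (hermiteTensor β j).eval (y j)) * hode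

end Eigenfunctions

/-! ### Testing with functions of exponential growth -/

section Cutoff

variable {N : ℕ}

theorem partialD_partialD_mul (i : Fin N) {f g : Space N → ℝ} (hf : ContDiff ℝ ∞ f)
    (hg : ContDiff ℝ ∞ g) (y : Space N) :
    partialD i (partialD i fun y => f y * g y) y = partialD i (partialD i f) y * g y +
      2 * (partialD i f y * partialD i g y) + f y * partialD i (partialD i g) y := by
  have differentiable {h : Space N → ℝ} (hh : ContDiff ℝ ∞ h) : Differentiable ℝ h :=
    hh.differentiable (by simp)
  have hf' := differentiable (contDiff_partialD i hf)
  have hg' := differentiable (contDiff_partialD i hg)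
  rw [show (partialD i fun y => f y * g y) =
      fun y => partialD i f y * g y + f y * partialD i g y from
      funext fun y => partialD_mul i (differentiable hf y) (differentiable hg y),
    partialD, fderiv_fun_add ((hf' y).fun_mul (differentiable hg y))
      ((differentiable hf y).fun_mul (hg' y)), add_apply]
  change partialD i (fun y => partialD i f y * g y) y +
    partialD i (fun y => f y * partialD i g y) y = _
  rw [partialD_mul i (hf' y) (differentiable hg y), partialD_mul i (differentiable hf y) (hg' y)]
  ring

theorem adjointL_mul {f g : Space N → ℝ} (hf : ContDiff ℝ ∞ f) (hg : ContDiff ℝ ∞ g)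
    (y : Space N) :
    adjointL (fun y => f y * g y) y = f y * adjointL g y +
      ∑ i, (1 / 2 * (y i * partialD i f y * g y) - partialD i (partialD i f) y * g y -
        2 * (partialD i f y * partialD i g y)) := by
  rw [adjointL_eq_sum (hf.mul hg), adjointL_eq_sum hg, Finset.mul_sum, ← Finset.sum_add_distrib]
  refine Finset.sum_congr rfl fun i _ => ?_
  rw [partialD_partialD_mul i hf hg, partialD_mul i (hf.differentiable (by simp) y)
    (hg.differentiable (by simp) y)]
  ring

theorem partialD_comp_smul (i : Fin N) (φ : Space N → ℝ) (ε : ℝ) :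
    partialD i (fun y => φ (ε • y)) = fun y => ε * partialD i φ (ε • y) := by
  funext y
  rw [partialD, fderiv_comp_smul]
  simp [partialD]

theorem partialD_partialD_comp_smul (i : Fin N) {φ : Space N → ℝ} (h : ContDiff ℝ ∞ φ) (ε : ℝ)
    (y : Space N) :
    partialD i (partialD i fun y => φ (ε • y)) y =
      ε ^ 2 * partialD i (partialD i φ) (ε • y) := by
  have hd : DifferentiableAt ℝ (fun y => partialD i φ (ε • y)) y :=
    (((contDiff_partialD i h).comp (contDiff_const_smul ε)).differentiable (by simp)) y
  rw [partialD_comp_smul, partialD, fderiv_const_mul hd, smul_apply, smul_eq_mul]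
  change ε * partialD i (fun y => partialD i φ (ε • y)) y = _
  rw [partialD_comp_smul]
  ring

theorem adjointL_cutoff {χ P : Space N → ℝ} (hχ : ContDiff ℝ ∞ χ) (hP : ContDiff ℝ ∞ P)
    (ε : ℝ) (y : Space N) :
    adjointL (fun y => χ (ε • y) * P y) y = χ (ε • y) * adjointL P y +
      ∑ i, (1 / 2 * ((ε • y) i * partialD i χ (ε • y) * P y) -
        ε ^ 2 * (partialD i (partialD i χ) (ε • y) * P y) -
        2 * ε * (partialD i χ (ε • y) * partialD i P y)) := by
  rw [adjointL_mul (f := fun y => χ (ε • y)) (hχ.comp (contDiff_const_smul ε)) hP]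
  congr 1
  refine Finset.sum_congr rfl fun i _ => ?_
  rw [partialD_partialD_comp_smul i hχ, partialD_comp_smul, PiLp.smul_apply, smul_eq_mul]
  ring

theorem tendsto_integral_mul_of_dominated (u : L2K N) {F : ℕ → Space N → ℝ} {G Q : Space N → ℝ}
    (hF : ∀ n, Continuous (F n)) (hQ : HasExpGrowth Q) (bound : ∀ n y, |F n y| ≤ Q y)
    (hlim : ∀ y, Tendsto (fun n => F n y) atTop (𝓝 (G y))) :
    Tendsto (fun n => ∫ y, u y * F n y) atTop (𝓝 (∫ y, u y * G y)) := by
  have hu : AEStronglyMeasurable u (volume : Measure (Space N)) :=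
    (Lp.aestronglyMeasurable u).mono_ac (volume_absolutelyContinuous N)
  refine tendsto_integral_of_dominated_convergence (fun y => ‖u y * Q y‖)
    (fun n => hu.mul (hF n).aestronglyMeasurable) (hQ.integrable_mul u).norm
    (fun n => Eventually.of_forall fun y => ?_)
    (Eventually.of_forall fun y => (hlim y).const_mul (u y))
  rw [norm_mul, norm_mul]
  gcongr
  exact (bound n y).trans (le_abs_self _)

theorem tendsto_adjointL_cutoff {χ P : Space N → ℝ} (hχ : ContDiff ℝ ∞ χ) (hP : ContDiff ℝ ∞ P)
    {ε : ℕ → ℝ} (hε : Tendsto ε atTop (𝓝 0)) (y : Space N) :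
    Tendsto (fun n => adjointL (fun y => χ (ε n • y) * P y) y) atTop
      (𝓝 (χ 0 * adjointL P y)) := by
  have hlim {g : Space N → ℝ} (hg : ContDiff ℝ ∞ g) :
      Tendsto (fun n => g (ε n • y)) atTop (𝓝 (g 0)) :=
    (hg.continuous.tendsto' 0 _ rfl).comp (by simpa using hε.smul_const y)
  have hcoord (i : Fin N) : Tendsto (fun n => (ε n • y) i) atTop (𝓝 0) := by
    simpa using hε.mul_const (y i)
  have hterm (i : Fin N) := (((((hcoord i).mul (hlim (contDiff_partialD i hχ))).mul_const
    (P y)).const_mul (1 / 2)).sub ((hε.pow 2).mul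
      ((hlim (contDiff_partialD i (contDiff_partialD i hχ))).mul_const (P y)))).sub
    ((hε.const_mul 2).mul ((hlim (contDiff_partialD i hχ)).mul_const (partialD i P y)))
  simpa only [adjointL_cutoff hχ hP, zero_mul, mul_zero, sub_zero, Finset.sum_const_zero, add_zero,
    ne_eq, OfNat.ofNat_ne_zero, not_false_eq_true, zero_pow] using
    ((hlim hχ).mul_const (adjointL P y)).add (tendsto_finsetSum Finset.univ fun i _ => hterm i)

theorem exists_bound_adjointL_cutoff {χ P : Space N → ℝ}
    (hχ : ContDiff ℝ ∞ χ ∧ HasCompactSupport χ) (hP : ContDiff ℝ ∞ P) (hPgrowth : HasExpGrowth P)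
    (hP' : ∀ i, HasExpGrowth (partialD i P)) (hLP : HasExpGrowth (adjointL P)) :
    ∃ Q : Space N → ℝ, HasExpGrowth Q ∧ ∀ ε ∈ Icc (0 : ℝ) 1, ∀ y,
      |adjointL (fun y => χ (ε • y) * P y) y| ≤ Q y := by
  have bounded {g : Space N → ℝ} (hg : ContDiff ℝ ∞ g ∧ HasCompactSupport g) :
      ∃ C, ∀ y, |g y| ≤ C := hg.2.exists_bound_of_continuous hg.1.continuous
  obtain ⟨A, hA⟩ := bounded hχ
  choose B hB using fun i => bounded (partialD_smooth i hχ)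
  choose C hC using fun i => bounded (coord_mul_smooth i (partialD_smooth i hχ))
  choose D hD using fun i => bounded (partialD_smooth i (partialD_smooth i hχ))
  refine ⟨fun y => A * |adjointL P y| +
    ∑ i, (1 / 2 * (C i * |P y|) + D i * |P y| + 2 * (B i * |partialD i P y|)),
    (hLP.abs.const_mul A).add (.sum _ fun i => (((hPgrowth.abs.const_mul _).const_mul _).add
      (hPgrowth.abs.const_mul _)).add (((hP' i).abs.const_mul _).const_mul _)),
    fun ε hε y => ?_⟩
  have mul_le {a b c : ℝ} (h : |a| ≤ c) : |a * b| ≤ c * |b| := by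
    rw [abs_mul]
    gcongr
  have scale_le {t a : ℝ} (ht : t ∈ Icc (0 : ℝ) 1) : |t * a| ≤ |a| := by
    rw [abs_mul, abs_of_nonneg ht.1]
    exact mul_le_of_le_one_left (abs_nonneg a) ht.2
  rw [adjointL_cutoff hχ.1 hP]
  refine (abs_add_le _ _).trans (add_le_add (mul_le (hA _))
    ((Finset.abs_sum_le_sum_abs _ _).trans (Finset.sum_le_sum fun i _ => ?_)))
  refine (abs_sub _ _).trans (add_le_add ((abs_sub _ _).trans (add_le_add ?_ ?_)) ?_)
  · rw [abs_mul, abs_of_pos (by norm_num : (0 : ℝ) < 1 / 2)]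
    gcongr
    exact mul_le (hC i _)
  · exact (scale_le ⟨by positivity, pow_le_one₀ hε.1 hε.2⟩).trans (mul_le (hD i _))
  · rw [mul_assoc, abs_mul, abs_two]
    gcongr
    exact (scale_le hε).trans (mul_le (hB i _))

theorem WeakL.integral_eq {u f : L2K N} (h : WeakL u f) {P : Space N → ℝ} (hP : ContDiff ℝ ∞ P)
    (hPgrowth : HasExpGrowth P) (hP' : ∀ i, HasExpGrowth (partialD i P))
    (hLP : HasExpGrowth (adjointL P)) : ∫ y, u y * adjointL P y = ∫ y, f y * P y := by
  let χ : ContDiffBump (0 : Space N) := ⟨1, 2, by norm_num, by norm_num⟩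
  have hχ : ContDiff ℝ ∞ χ ∧ HasCompactSupport χ := ⟨χ.contDiff, χ.hasCompactSupport⟩
  have hχ0 : χ 0 = 1 := χ.one_of_mem_closedBall (by simp [χ.rIn_pos.le])
  let ε : ℕ → ℝ := fun n => 1 / ((n : ℝ) + 1)
  have hε : Tendsto ε atTop (𝓝 0) := tendsto_one_div_add_atTop_nhds_zero_nat
  have hε1 (n : ℕ) : ε n ∈ Icc (0 : ℝ) 1 :=
    ⟨by positivity, (div_le_one (by positivity)).2 (by simp)⟩
  have htest (n : ℕ) : ContDiff ℝ ∞ (fun y => χ (ε n • y) * P y) ∧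
      HasCompactSupport fun y => χ (ε n • y) * P y :=
    ⟨(hχ.1.comp (contDiff_const_smul (ε n))).mul hP,
      (hχ.2.comp_homeomorph (Homeomorph.smulOfNeZero (ε n) (by positivity))).mul_right⟩
  obtain ⟨Q, hQ, hQbound⟩ := exists_bound_adjointL_cutoff hχ hP hPgrowth hP' hLP
  obtain ⟨C, hC⟩ := hχ.2.exists_bound_of_continuous hχ.1.continuous
  have hleft := tendsto_integral_mul_of_dominated u
    (fun n => (HasExpGrowth.adjointL_of_test (htest n)).continuous) hQ
    (fun n => hQbound (ε n) (hε1 n)) (tendsto_adjointL_cutoff hχ.1 hP hε)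
  have hright := tendsto_integral_mul_of_dominated (Q := fun y => C * |P y|)
    (G := fun y => χ 0 * P y) f (fun n => (htest n).1.continuous) (hPgrowth.abs.const_mul C)
    (fun n y => by rw [abs_mul]; gcongr; exact hC _)
    fun y => (((χ.continuous.tendsto' 0 _ rfl).comp
      (by simpa using hε.smul_const y)).mul_const (P y))
  simp only [hχ0, one_mul] at hleft hright
  exact tendsto_nhds_unique hleft
    (hright.congr fun n => (h _ (htest n).1 (htest n).2).symm)

theorem WeakL.inner_hermiteE {u f : L2K N} (h : WeakL u f) (β : Fin N → ℕ) :
    inner ℝ (hermiteE β) f = (eigenvalue β + (N : ℝ) / 2) * inner ℝ (hermiteE β) u := by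
  have hL : adjointL (polyTensor (hermiteTensor β)) =
      fun y => (eigenvalue β + (N : ℝ) / 2) * polyTensor (hermiteTensor β) y :=
    funext (adjointL_polyTensor β)
  have key := h.integral_eq (contDiff_polyTensor (hermiteTensor β)) (.polyTensor _)
    (fun i => by rw [partialD_polyTensor]; exact .polyTensor _)
    (by rw [hL]; exact (HasExpGrowth.polyTensor _).const_mul _)
  simp only [hL, mul_left_comm _ (eigenvalue β + (N : ℝ) / 2)] at key
  rw [integral_const_mul] at key
  rw [hermiteE, real_inner_smul_left, real_inner_smul_left, inner_gaussL2, inner_gaussL2, ← key]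
  ring

end Cutoff

/-! ### Multipliers in the Hermite basis -/

section ShiftFactor

variable {N : ℕ}

theorem shiftFactor_nonneg (α β : Fin N → ℕ) : 0 ≤ shiftFactor α β := by
  unfold shiftFactor
  positivity

theorem shiftFactor_zero (β : Fin N → ℕ) : shiftFactor 0 β = 1 := by
  rw [shiftFactor, add_zero, div_self (Real.sqrt_pos.2 (hermiteNormSq_pos β)).ne']

theorem shiftFactor_sq (α β : Fin N → ℕ) :
    shiftFactor α β ^ 2 = ∏ j, (β j + 1).ascFactorial (α j) / (2 : ℝ) ^ α j := by
  rw [shiftFactor, div_pow, Real.sq_sqrt (hermiteNormSq_pos _).le,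
    Real.sq_sqrt (hermiteNormSq_pos _).le, hermiteNormSq, hermiteNormSq, ← Finset.prod_div_distrib]
  refine Finset.prod_congr rfl fun j _ => ?_
  have hfact : ((β j).factorial : ℝ) ≠ 0 := by positivity
  rw [Pi.add_apply, ← Nat.factorial_mul_ascFactorial, pow_add]
  push_cast
  field_simp

theorem shiftFactor_single_sq (i : Fin N) (β : Fin N → ℕ) :
    shiftFactor (Pi.single i 1) β ^ 2 = ((β i : ℝ) + 1) / 2 := by
  rw [shiftFactor_sq, Finset.prod_eq_single i (fun j _ hj => by simp [hj]) (by simp)]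
  simp [Nat.ascFactorial_succ]

theorem apply_le_two_mul_eigenvalue (β : Fin N → ℕ) (j : Fin N) : (β j : ℝ) ≤ 2 * eigenvalue β := by
  rw [eigenvalue, mul_div_cancel₀ _ two_ne_zero]
  exact Finset.single_le_sum (f := fun i => (β i : ℝ)) (fun i _ => by positivity)
    (Finset.mem_univ j)

theorem shiftFactor_sq_le {m : ℕ} {α : Fin N → ℕ} (hα : ∑ i, α i ≤ m) (β : Fin N → ℕ) :
    shiftFactor α β ^ 2 ≤ (2 * eigenvalue β + m + 1) ^ m := by
  have hbase : 1 ≤ 2 * eigenvalue β + m + 1 := by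
    linarith [eigenvalue_nonneg β, m.cast_nonneg (α := ℝ)]
  have hfactor : ∀ j, (β j + 1).ascFactorial (α j) / (2 : ℝ) ^ α j ≤
      (2 * eigenvalue β + m + 1) ^ α j := fun j => by
    have hαj : (α j : ℝ) ≤ m :=
      mod_cast (Finset.single_le_sum (fun i _ => Nat.zero_le (α i)) (Finset.mem_univ j)).trans hα
    calc (β j + 1).ascFactorial (α j) / (2 : ℝ) ^ α j
        ≤ (β j + 1).ascFactorial (α j) :=
          div_le_self (by positivity) (one_le_pow₀ one_le_two)
      _ ≤ ((β j : ℝ) + α j) ^ α j := mod_cast Nat.ascFactorial_le_pow_add _ _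
      _ ≤ (2 * eigenvalue β + m + 1) ^ α j := by
          refine pow_le_pow_left₀ (by positivity) ?_ _
          linarith [apply_le_two_mul_eigenvalue β j]
  calc shiftFactor α β ^ 2 ≤ ∏ j, (2 * eigenvalue β + m + 1) ^ α j := by
        rw [shiftFactor_sq]
        exact Finset.prod_le_prod (fun j _ => by positivity) fun j _ => hfactor j
    _ = (2 * eigenvalue β + m + 1) ^ (∑ j, α j) := Finset.prod_pow_eq_pow_sum _ _ _
    _ ≤ (2 * eigenvalue β + m + 1) ^ m := pow_le_pow_right₀ hbase hα

theorem isBdd_exp_mul_shiftFactor (α : Fin N → ℕ) {s : ℝ} (hs : 0 < s) :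
    IsBdd fun β => Real.exp (-(eigenvalue β * s)) * shiftFactor α β := by
  set m := ∑ i, α i with hm
  refine ⟨√(Real.exp ((m + 1) * s) * m.factorial / s ^ m), fun β => Real.abs_le_sqrt ?_⟩
  have hx : 0 ≤ (2 * eigenvalue β + m + 1) * s := by
    have := eigenvalue_nonneg β
    positivity
  have hpow : (2 * eigenvalue β + m + 1) ^ m ≤
      Real.exp ((2 * eigenvalue β + m + 1) * s) * m.factorial / s ^ m := by
    have hexp := Real.pow_div_factorial_le_exp _ hx m
    rwa [mul_pow, div_le_iff₀ (by positivity), ← le_div_iff₀ (by positivity)] at hexp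
  calc (Real.exp (-(eigenvalue β * s)) * shiftFactor α β) ^ 2
      = Real.exp (-(eigenvalue β * s)) ^ 2 * shiftFactor α β ^ 2 := mul_pow _ _ _
    _ ≤ Real.exp (-(eigenvalue β * s)) ^ 2 *
          (Real.exp ((2 * eigenvalue β + m + 1) * s) * m.factorial / s ^ m) := by
        gcongr
        exact (shiftFactor_sq_le hm.ge β).trans hpow
    _ = Real.exp ((m + 1) * s) * m.factorial / s ^ m := by
        rw [← mul_div_assoc, ← mul_assoc, ← Real.exp_nat_mul, ← Real.exp_add]
        push_cast
        ring_nf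

theorem isBdd_resolvent_mul_shiftFactor {α : Fin N → ℕ} (hα : ∑ i, α i ≤ 2) :
    IsBdd fun β => (1 + 2 * eigenvalue β)⁻¹ * shiftFactor α β := by
  refine ⟨3, fun β => ?_⟩
  have hnonneg := eigenvalue_nonneg β
  rw [abs_of_nonneg (mul_nonneg (by positivity) (shiftFactor_nonneg α β)),
    inv_mul_le_iff₀ (by positivity)]
  have hle := abs_le_of_sq_le_sq (shiftFactor_sq_le hα β) (by positivity)
  push_cast at hle
  linarith [le_abs_self (shiftFactor α β)]

theorem isBdd_resolvent_mul_eigenvalue :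
    IsBdd fun β : Fin N → ℕ => (1 + 2 * eigenvalue β)⁻¹ * (eigenvalue β + (N : ℝ) / 2) := by
  refine ⟨1 + N, fun β => ?_⟩
  have hnonneg := eigenvalue_nonneg β
  rw [abs_of_nonneg (by positivity), inv_mul_le_iff₀ (by positivity)]
  nlinarith [mul_nonneg hnonneg (N.cast_nonneg (α := ℝ)), N.cast_nonneg (α := ℝ)]

end ShiftFactor

section Multiplier

variable {N m : ℕ} {a : (Fin N → ℕ) → ℝ}

theorem orthonormal_hermiteE_add (α : Fin N → ℕ) :
    Orthonormal ℝ fun β : Fin N → ℕ => hermiteE (β + α) :=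
  (orthonormal_hermiteE N).comp _ (add_left_injective α)

/-- The operator `u ↦ ∑ β, a β (e_β, u) e_{β + α}`. For `a β = c β * shiftFactor α β` it is `D^α`
composed with the multiplier `c`. -/
noncomputable def hermiteShift (α : Fin N → ℕ) (ha : IsBdd a) : L2K N →L[ℝ] L2K N :=
  weightedShift (hermiteBasis N) (orthonormal_hermiteE_add α) ha

theorem hermiteShift_diagonal {α : Fin N → ℕ} {c d : (Fin N → ℕ) → ℝ} (ha : IsBdd a)
    (hc : IsBdd c) (hd : IsBdd d) (h : ∀ β, d β = a β * c β) (u : L2K N) :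
    hermiteShift α ha (diagonal (hermiteBasis N) hc u) = hermiteShift α hd u := by
  refine (hasSum_weightedShift _ _ ha _).unique
    ((hasSum_weightedShift _ _ hd u).congr_fun fun β => ?_)
  rw [inner_diagonal, h, mul_assoc]

theorem hasWeakDeriv_diagonal {α : Fin N → ℕ} (ha : IsBdd a)
    (hα : IsBdd fun β => a β * shiftFactor α β) (u : L2K N) :
    HasWeakDeriv α (diagonal (hermiteBasis N) ha u) (hermiteShift α hα u) := by
  refine .of_hasSum (fun β => ?_) (hasSum_diagonal (hermiteBasis N) ha u)
    (hasSum_weightedShift _ _ hα u)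
  rw [hermiteBasis_apply, mul_right_comm, mul_smul _ (shiftFactor α β)]
  exact (hasWeakDeriv_hermiteE α β).smul _

theorem weakL_diagonal (ha : IsBdd a) (h : IsBdd fun β => a β * (eigenvalue β + (N : ℝ) / 2))
    (u : L2K N) : WeakL (diagonal (hermiteBasis N) ha u) (diagonal (hermiteBasis N) h u) := by
  refine .of_hasSum (fun β => ?_) (hasSum_diagonal (hermiteBasis N) ha u)
    (hasSum_diagonal (hermiteBasis N) h u)
  rw [hermiteBasis_apply, mul_right_comm, mul_smul _ (eigenvalue β + (N : ℝ) / 2)]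
  exact (weakL_hermiteE β).smul _

theorem hasSum_sq_gradient (h : ∀ i : Fin N, IsBdd fun β => a β * shiftFactor (Pi.single i 1) β)
    (u : L2K N) :
    HasSum (fun β => (eigenvalue β + (N : ℝ) / 2) * (a β * inner ℝ (hermiteE β) u) ^ 2)
      (∑ i, ‖hermiteShift (Pi.single i 1) (h i) u‖ ^ 2) := by
  refine (hasSum_sum fun i (_ : i ∈ Finset.univ) =>
    hasSum_sq_weightedShift (hermiteBasis N) _ (h i) u).congr_fun fun β => ?_
  rw [← sum_add_one_div_two, Finset.sum_mul]
  refine Finset.sum_congr rfl fun i _ => ?_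
  rw [hermiteBasis_apply, ← shiftFactor_single_sq]
  ring

/-- The condition under which the multiplier `a` maps `L²(K)` to `H^m(K)`. -/
def IsRegular (m : ℕ) (a : (Fin N → ℕ) → ℝ) : Prop :=
  ∀ α ∈ multiIndices N m, IsBdd fun β => a β * shiftFactor α β

theorem IsRegular.isBdd (ha : IsRegular m a) : IsBdd a := by
  simpa only [shiftFactor_zero, mul_one] using ha 0 (zeroIndex N m).2

theorem isRegular_exp (m : ℕ) {s : ℝ} (hs : 0 < s) :
    IsRegular m fun β : Fin N → ℕ => Real.exp (-(eigenvalue β * s)) :=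
  fun α _ => isBdd_exp_mul_shiftFactor α hs

theorem isRegular_resolvent : IsRegular 2 fun β : Fin N → ℕ => (1 + 2 * eigenvalue β)⁻¹ :=
  fun _ hα => isBdd_resolvent_mul_shiftFactor (mem_multiIndices.1 hα)

theorem hermiteShift_zero (ha : IsRegular m a) (u : L2K N) :
    hermiteShift 0 (ha 0 (zeroIndex N m).2) u = diagonal (hermiteBasis N) ha.isBdd u := by
  refine (hasSum_weightedShift _ _ _ u).unique
    ((hasSum_diagonal (hermiteBasis N) ha.isBdd u).congr_fun fun β => ?_)
  rw [shiftFactor_zero, mul_one, add_zero, hermiteBasis_apply]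

/-- The multiplier `a` as an operator from `L²(K)` to `H^m(K)`. -/
noncomputable def sobolevMultiplier (ha : IsRegular m a) : L2K N →L[ℝ] HK N m :=
  ((PiLp.continuousLinearEquiv 2 ℝ fun _ : multiIndices N m => L2K N).symm.toContinuousLinearMap ∘L
    ContinuousLinearMap.pi fun α => hermiteShift α.1 (ha α.1 α.2)).codRestrict (HK N m)
    fun u α => by
      have h := hasWeakDeriv_diagonal ha.isBdd (ha α.1 α.2) u
      rw [← hermiteShift_zero ha] at h
      exact h

theorem toL2K_sobolevMultiplier (ha : IsRegular m a) (u : L2K N) :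
    toL2K (sobolevMultiplier ha u) = diagonal (hermiteBasis N) ha.isBdd u :=
  hermiteShift_zero ha u

theorem sobolevMultiplier_diagonal {c d : (Fin N → ℕ) → ℝ} (ha : IsRegular m a) (hc : IsBdd c)
    (hd : IsRegular m d) (h : ∀ β, d β = a β * c β) (u : L2K N) :
    sobolevMultiplier ha (diagonal (hermiteBasis N) hc u) = sobolevMultiplier hd u :=
  Subtype.ext <| PiLp.ext fun α =>
    hermiteShift_diagonal (ha α.1 α.2) hc (hd α.1 α.2) (fun β => by rw [h, mul_right_comm]) u

theorem isL_diagonal (ha : IsRegular 2 a)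
    (h : IsBdd fun β => a β * (eigenvalue β + (N : ℝ) / 2)) (u : L2K N) :
    IsL (diagonal (hermiteBasis N) ha.isBdd u) (diagonal (hermiteBasis N) h u) := by
  have hmem : ∀ (i : Fin N) (k : ℕ), k ≤ 2 → Pi.single i k ∈ multiIndices N 2 := fun i k hk =>
    mem_multiIndices.2 (by simpa [Finset.univ_sum_single] using hk)
  have hfirst := fun i => hasWeakDeriv_diagonal ha.isBdd (ha _ (hmem i 1 one_le_two)) u
  have hsecond := fun i => hasWeakDeriv_diagonal ha.isBdd (ha _ (hmem i 2 le_rfl)) u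
  exact ⟨⟨sobolevMultiplier ha u, toL2K_sobolevMultiplier ha u⟩, _, _, hfirst, hsecond,
    (weakL_diagonal ha.isBdd h u).ae_eq hfirst hsecond⟩

theorem ext_inner_hermiteE {u v : L2K N}
    (h : ∀ β, inner ℝ (hermiteE β) u = inner ℝ (hermiteE β) v) : u = v :=
  ext_inner_hilbertBasis (hermiteBasis N) fun β => by rw [hermiteBasis_apply, h]

theorem inner_hermiteE_diagonal (ha : IsBdd a) (u : L2K N) (β : Fin N → ℕ) :
    inner ℝ (hermiteE β) (diagonal (hermiteBasis N) ha u) = a β * inner ℝ (hermiteE β) u := by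
  simpa only [hermiteBasis_apply] using inner_diagonal (hermiteBasis N) ha u β

theorem isL_iff_inner {u f : L2K N} : IsL u f ↔
    ∀ β, inner ℝ (hermiteE β) f = (eigenvalue β + (N : ℝ) / 2) * inner ℝ (hermiteE β) u := by
  refine ⟨fun h => h.weakL.inner_hermiteE, fun h => ?_⟩
  -- `u` lies in the range of the resolvent `(1 + 2 (L - N/2))⁻¹`.
  have hres := isL_diagonal isRegular_resolvent isBdd_resolvent_mul_eigenvalue
    (u + (2 : ℝ) • (f - ((N : ℝ) / 2) • u))
  have hcoeff : ∀ β, inner ℝ (hermiteE β) (u + (2 : ℝ) • (f - ((N : ℝ) / 2) • u)) =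
      (1 + 2 * eigenvalue β) * inner ℝ (hermiteE β) u := fun β => by
    rw [inner_add_right, real_inner_smul_right, inner_sub_right, real_inner_smul_right, h]
    ring
  have hne : ∀ β : Fin N → ℕ, 1 + 2 * eigenvalue β ≠ 0 := fun β => by
    have := eigenvalue_nonneg β
    positivity
  convert! hres using 1
  · refine ext_inner_hermiteE fun β => ?_
    rw [inner_hermiteE_diagonal, hcoeff, inv_mul_cancel_left₀ (hne β)]
  · refine ext_inner_hermiteE fun β => ?_
    rw [inner_hermiteE_diagonal, hcoeff, h, mul_right_comm, ← mul_assoc,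
      inv_mul_cancel₀ (hne β), one_mul, mul_comm]

end Multiplier

/-! ### The heat semigroup in similarity variables -/

section HeatSemigroup

variable {N : ℕ} {s : ℝ}

/-- The semigroup generated by `-(L - N/2)`, extended by the identity to negative times. -/
noncomputable def heatS (N : ℕ) (s : ℝ) : L2K N →L[ℝ] L2K N :=
  diagonalSemigroup (hermiteBasis N) eigenvalue_nonneg s

/-- The operator `(L - N/2) S(s)`, for `s > 0`. -/
noncomputable def heatG (N : ℕ) {s : ℝ} (hs : 0 < s) : L2K N →L[ℝ] L2K N :=
  diagonalSemigroupGen (hermiteBasis N) eigenvalue_nonneg hs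

theorem inner_heatS (hs : 0 ≤ s) (u : L2K N) (β : Fin N → ℕ) :
    inner ℝ (hermiteE β) (heatS N s u) =
      Real.exp (-(eigenvalue β * s)) * inner ℝ (hermiteE β) u := by
  simpa only [heatS, hermiteBasis_apply] using
    inner_diagonalSemigroup (hermiteBasis N) eigenvalue_nonneg hs u β

theorem inner_heatG (hs : 0 < s) (u : L2K N) (β : Fin N → ℕ) :
    inner ℝ (hermiteE β) (heatG N hs u) =
      Real.exp (-(eigenvalue β * s)) * eigenvalue β * inner ℝ (hermiteE β) u := by
  simpa only [heatG, hermiteBasis_apply] using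
    inner_diagonalSemigroupGen (hermiteBasis N) eigenvalue_nonneg hs u β

theorem diagonal_exp_eq_heatS (hs : 0 ≤ s) (u : L2K N) :
    diagonal (hermiteBasis N) (isBdd_exp eigenvalue_nonneg hs) u = heatS N s u :=
  ext_inner_hermiteE fun β => by rw [inner_heatS hs, inner_hermiteE_diagonal]

theorem continuous_heatS (u : L2K N) : Continuous fun s => heatS N s u :=
  continuous_diagonalSemigroup (hermiteBasis N) eigenvalue_nonneg u

theorem hasDerivAt_heatS (hs : 0 < s) (u : L2K N) :
    HasDerivAt (fun σ => heatS N σ u) (-heatG N hs u) s :=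
  hasDerivAt_diagonalSemigroup (hermiteBasis N) eigenvalue_nonneg hs u

theorem isL_heatS (hs : 0 < s) (u : L2K N) :
    IsL (heatS N s u) (heatG N hs u + ((N : ℝ) / 2) • heatS N s u) :=
  isL_iff_inner.2 fun β => by
    rw [inner_add_right, real_inner_smul_right, inner_heatG, inner_heatS hs.le]
    ring

theorem tendsto_slope_heatS_iff (u w : L2K N) :
    Tendsto (fun h : ℝ => h⁻¹ • (heatS N h u - u)) (𝓝[>] 0) (𝓝 w) ↔
      ∃ f, IsL u f ∧ w = -(f - ((N : ℝ) / 2) • u) := by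
  simp only [heatS, tendsto_slope_diagonalSemigroup_iff, hermiteBasis_apply, isL_iff_inner]
  constructor
  · refine fun hw => ⟨((N : ℝ) / 2) • u - w, fun β => ?_, by abel⟩
    rw [inner_sub_right, real_inner_smul_right, hw]
    ring
  · rintro ⟨f, hf, rfl⟩ β
    rw [inner_neg_right, inner_sub_right, real_inner_smul_right, hf]
    ring

theorem isHeatSemigroup_heatS (N : ℕ) : IsHeatSemigroup (heatS N) where
  zero := diagonalSemigroup_zero (hermiteBasis N) eigenvalue_nonneg
  add _ _ := diagonalSemigroup_add (hermiteBasis N) eigenvalue_nonneg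
  continuousOn u := (continuous_heatS u).continuousOn
  contraction _ := norm_diagonalSemigroup_le_one (hermiteBasis N) eigenvalue_nonneg
  generator := tendsto_slope_heatS_iff

theorem toL2K_sobolevMultiplier_exp (m : ℕ) (hs : 0 < s) (u : L2K N) :
    toL2K (sobolevMultiplier (isRegular_exp m hs) u) = heatS N s u := by
  rw [toL2K_sobolevMultiplier, diagonal_exp_eq_heatS hs.le]

theorem sobolevMultiplier_heatS (m : ℕ) {t : ℝ} (hs : 0 < s) (ht : 0 ≤ t) (u : L2K N) :
    sobolevMultiplier (isRegular_exp m hs) (heatS N t u) =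
      sobolevMultiplier (isRegular_exp m (add_pos_of_pos_of_nonneg hs ht)) u := by
  rw [← diagonal_exp_eq_heatS ht]
  refine sobolevMultiplier_diagonal _ _ _ (fun β => ?_) u
  rw [← Real.exp_add]
  congr 1
  ring

theorem smoothInHK_heatS (m : ℕ) (u : L2K N) : SmoothInHK m fun s => heatS N s u := by
  classical
  refine ⟨fun s => if hs : 0 < s then sobolevMultiplier (isRegular_exp m hs) u else 0,
    fun s (hs : 0 < s) => ?_, fun s hs => ?_⟩
  · have hs' := half_pos hs
    have hheat : ContDiffAt ℝ ∞ (fun t => heatS N t u) (s - s / 2) :=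
      (contDiffOn_diagonalSemigroup _ eigenvalue_nonneg u).contDiffAt
        (Ioi_mem_nhds (sub_pos.2 (half_lt_self hs)))
    have hcomp : ContDiffAt ℝ ∞
        (fun t => sobolevMultiplier (isRegular_exp m hs') (heatS N (t - s / 2) u)) s :=
      (sobolevMultiplier (isRegular_exp m hs')).contDiff.contDiffAt.comp s
        (hheat.comp s (contDiffAt_id.sub contDiffAt_const))
    refine (hcomp.congr_of_eventuallyEq ?_).contDiffWithinAt
    filter_upwards [Ioi_mem_nhds (half_lt_self hs)] with t (ht : s / 2 < t)
    rw [dif_pos (hs'.trans ht), sobolevMultiplier_heatS m hs' (by linarith)]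
    simp only [add_sub_cancel]
  · simp only [dif_pos hs]
    exact toL2K_sobolevMultiplier_exp m hs u

theorem inner_heatS_phiOne (hs : 0 ≤ s) (u : L2K N) :
    inner ℝ (heatS N s u) (phiOne N) = inner ℝ u (phiOne N) := by
  rw [← hermiteE_zero, real_inner_comm, inner_heatS hs, real_inner_comm]
  simp [eigenvalue]

theorem half_le_eigenvalue {β : Fin N → ℕ} (hβ : β ≠ 0) : 1 / 2 ≤ eigenvalue β := by
  obtain ⟨i, hi⟩ := Function.ne_iff.1 hβ
  have hone : (1 : ℝ) ≤ β i := mod_cast Nat.one_le_iff_ne_zero.2 hi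
  linarith [apply_le_two_mul_eigenvalue β i]

theorem norm_heatS_le_of_mem_orthogonal {u : L2K N} (hu : u ∈ (firstEigenspace N)ᗮ)
    (hs : 0 ≤ s) : ‖heatS N s u‖ ≤ Real.exp (-s / 2) * ‖u‖ := by
  have h := norm_diagonalSemigroup_apply_le (hermiteBasis N) eigenvalue_nonneg hs (u := u)
    (c := 1 / 2) fun β => ?_
  · rwa [one_div_mul_eq_div, ← neg_div] at h
  · rw [hermiteBasis_apply]
    refine or_iff_not_imp_right.2 fun hβ => ?_
    rw [not_imp_comm.1 half_le_eigenvalue hβ, hermiteE_zero]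
    exact (Submodule.mem_orthogonal _ _).1 hu _ (Submodule.mem_span_singleton_self _)

theorem exists_norm_HK_le (N m : ℕ) : ∃ C : ℝ, 0 < C ∧ ∀ u ∈ (firstEigenspace N)ᗮ,
    ∀ s, 1 ≤ s → ∃ V : HK N m, toL2K V = heatS N s u ∧ ‖V‖ ≤ C * Real.exp (-s / 2) * ‖u‖ := by
  set T : L2K N →L[ℝ] HK N m := sobolevMultiplier (isRegular_exp m one_pos)
  refine ⟨(‖T‖ + 1) * Real.exp (1 / 2), by positivity, fun u hu s hs => ?_⟩
  have hs' : 0 ≤ s - 1 := sub_nonneg.2 hs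
  refine ⟨T (heatS N (s - 1) u), ?_, ?_⟩
  · rw [sobolevMultiplier_heatS m one_pos hs',
      toL2K_sobolevMultiplier_exp m (add_pos_of_pos_of_nonneg one_pos hs'), add_sub_cancel]
  · calc ‖T (heatS N (s - 1) u)‖ ≤ ‖T‖ * ‖heatS N (s - 1) u‖ := T.le_opNorm _
      _ ≤ (‖T‖ + 1) * (Real.exp (-(s - 1) / 2) * ‖u‖) := by
          gcongr
          · exact le_add_of_nonneg_right zero_le_one
          · exact norm_heatS_le_of_mem_orthogonal hu hs'
      _ = (‖T‖ + 1) * Real.exp (1 / 2) * Real.exp (-s / 2) * ‖u‖ := by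
          rw [mul_assoc (_ + 1), ← Real.exp_add, ← mul_assoc]
          ring_nf

theorem norm_heatG_le (hs : 0 < s) (u : L2K N) : ‖heatG N hs u‖ ≤ 1 / (√2 * s) * ‖u‖ := by
  refine (norm_diagonalSemigroupGen_apply_le _ eigenvalue_nonneg hs u).trans ?_
  have hsqrt : √2 ≤ Real.exp 1 :=
    (Real.sqrt_le_left (by norm_num)).2 (by norm_num) |>.trans
      (by linarith [Real.add_one_le_exp (1 : ℝ)] : (2 : ℝ) ≤ Real.exp 1)
  rw [Real.exp_neg, ← one_div, div_div]
  gcongr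

theorem exists_gradient_heatS (hs : 0 < s) (u : L2K N) :
    ∃ g : Fin N → L2K N, (∀ i, HasWeakDeriv (Pi.single i 1) (heatS N s u) (g i)) ∧
      (∑ i, ‖g i‖ ^ 2) - (N : ℝ) / 2 * ‖heatS N s u‖ ^ 2 ≤ 1 / (2 * s) * ‖u‖ ^ 2 := by
  have hbdd := fun i : Fin N => isBdd_exp_mul_shiftFactor (Pi.single i 1) hs
  refine ⟨fun i => hermiteShift (Pi.single i 1) (hbdd i) u, fun i => ?_, ?_⟩
  · rw [← diagonal_exp_eq_heatS hs.le]
    exact hasWeakDeriv_diagonal _ (hbdd i) u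
  · have hparseval := fun v : L2K N => hasSum_sq_inner (hermiteBasis N) v
    simp only [hermiteBasis_apply] at hparseval
    refine hasSum_le (fun β => ?_) ((hasSum_sq_gradient hbdd u).sub
      ((hparseval (heatS N s u)).mul_left ((N : ℝ) / 2))) ((hparseval u).mul_left (1 / (2 * s)))
    rw [inner_heatS hs.le, ← sub_mul, add_sub_cancel_right, mul_pow, ← mul_assoc]
    refine mul_le_mul_of_nonneg_right ?_ (sq_nonneg _)
    rw [← Real.exp_nat_mul, le_div_iff₀ (by positivity)]
    push_cast
    rw [mul_neg]
    linarith [mul_exp_neg_le_one (2 * (eigenvalue β * s))]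

end HeatSemigroup

/-! ### Space-time test functions -/

section TestFunctions

variable {N : ℕ} {φ : ℝ → Space N → ℝ}

/-- The time derivative of a function on space-time. -/
noncomputable def timeD (φ : ℝ → Space N → ℝ) (s : ℝ) (y : Space N) : ℝ :=
  deriv (fun σ => φ σ y) s

theorem hasDerivAt_fderiv_uncurry (h : ContDiff ℝ ∞ (Function.uncurry φ)) (s : ℝ)
    (y : Space N) :
    HasDerivAt (fun σ => φ σ y) (fderiv ℝ (Function.uncurry φ) (s, y) (1, 0)) s := by
  have hline : HasDerivAt (fun σ : ℝ => (σ, y)) (1, 0) s :=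
    (hasDerivAt_id s).prodMk (hasDerivAt_const s y)
  exact (h.differentiable (by simp) (s, y)).hasFDerivAt.comp_hasDerivAt s hline

theorem hasDerivAt_timeD (h : ContDiff ℝ ∞ (Function.uncurry φ)) (s : ℝ) (y : Space N) :
    HasDerivAt (fun σ => φ σ y) (timeD φ s y) s :=
  (hasDerivAt_fderiv_uncurry h s y).differentiableAt.hasDerivAt

theorem timeD_smooth
    (h : ContDiff ℝ ∞ (Function.uncurry φ) ∧ HasCompactSupport (Function.uncurry φ)) :
    ContDiff ℝ ∞ (Function.uncurry (timeD φ)) ∧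
      HasCompactSupport (Function.uncurry (timeD φ)) := by
  have huncurry : Function.uncurry (timeD φ) = fun p => fderiv ℝ (Function.uncurry φ) p (1, 0) :=
    funext fun p => (hasDerivAt_fderiv_uncurry h.1 p.1 p.2).deriv
  rw [huncurry]
  exact ⟨(h.1.fderiv_right (m := ∞) (by simp)).clm_apply contDiff_const, h.2.fderiv_apply ℝ _⟩

theorem slice_eq_zero {s : ℝ} (hs : s ∉ Prod.fst '' tsupport (Function.uncurry φ))
    (y : Space N) : φ s y = 0 := by
  by_contra hne
  exact hs ⟨(s, y), subset_closure hne, rfl⟩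

theorem slice_smooth
    (h : ContDiff ℝ ∞ (Function.uncurry φ) ∧ HasCompactSupport (Function.uncurry φ)) (s : ℝ) :
    ContDiff ℝ ∞ (φ s) ∧ HasCompactSupport (φ s) := by
  refine ⟨h.1.comp (contDiff_prodMk_right s), HasCompactSupport.intro (h.2.image continuous_snd)
    fun y hy => ?_⟩
  by_contra hne
  exact hy ⟨(s, y), subset_closure hne, rfl⟩

theorem exists_taylor_bound
    (h : ContDiff ℝ ∞ (Function.uncurry φ) ∧ HasCompactSupport (Function.uncurry φ)) :
    ∃ M : ℝ, ∀ s t y, |φ t y - φ s y - (t - s) * timeD φ s y| ≤ M * |t - s| ^ 2 := by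
  have htimeD := timeD_smooth h
  obtain ⟨M, hM⟩ := ContDiff.lipschitzWith_of_hasCompactSupport htimeD.2 htimeD.1 (by simp)
  refine ⟨M, fun s t y => ?_⟩
  have hremainder (r : ℝ) :
      HasDerivAt (fun r => φ r y - r * timeD φ s y) (timeD φ r y - timeD φ s y) r := by
    simpa only [id_eq, one_mul] using
      (hasDerivAt_timeD h.1 r y).fun_sub ((hasDerivAt_id r).mul_const (timeD φ s y))
  have hbound (r : ℝ) (hr : r ∈ uIcc s t) : |timeD φ r y - timeD φ s y| ≤ M * |t - s| := by
    have hlip := hM.dist_le_mul (r, y) (s, y)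
    rw [Real.dist_eq, Prod.dist_eq, dist_self, max_eq_left dist_nonneg, Real.dist_eq] at hlip
    exact hlip.trans (mul_le_mul_of_nonneg_left (abs_sub_left_of_mem_uIcc hr) M.2)
  have hmean := Convex.norm_image_sub_le_of_norm_hasDerivWithin_le
    (fun r _ => (hremainder r).hasDerivWithinAt) hbound (convex_uIcc s t)
    left_mem_uIcc right_mem_uIcc
  rw [Real.norm_eq_abs, Real.norm_eq_abs] at hmean
  convert! hmean using 1
  · congr 1
    ring
  · ring

theorem HasExpGrowth.norm_dual_sub_sub_smul_le {φ ψ χ ρ : Space N → ℝ} (hφ : HasExpGrowth φ)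
    (hψ : HasExpGrowth ψ) (hχ : HasExpGrowth χ) (hρ : HasExpGrowth ρ) {r C : ℝ}
    (h : ∀ y, |φ y - ψ y - r * χ y| ≤ C * |ρ y|) :
    ‖hφ.dual - hψ.dual - r • hχ.dual‖ ≤ C * ‖hρ.dual‖ := by
  refine Lp.norm_le_mul_norm_of_ae_le_mul ?_
  simp only [dual, ← MemLp.toLp_const_smul, ← MemLp.toLp_sub]
  filter_upwards [MemLp.coeFn_toLp ((hφ.memLp_div_weight.sub hψ.memLp_div_weight).sub
    (hχ.memLp_div_weight.const_smul r)), hρ.memLp_div_weight.coeFn_toLp] with y hy hρy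
  have hw := weight_pos N y
  rw [hy, hρy, Pi.sub_apply, Pi.sub_apply, Pi.smul_apply, smul_eq_mul, ← mul_div_assoc, ← sub_div,
    ← sub_div, Real.norm_eq_abs, Real.norm_eq_abs, abs_div, abs_div, abs_of_pos hw,
    ← mul_div_assoc]
  gcongr
  exact h y

/-- The element of `L²(K)` that represents the pairing with the slice `φ s`. -/
noncomputable def sliceDual
    (h : ContDiff ℝ ∞ (Function.uncurry φ) ∧ HasCompactSupport (Function.uncurry φ)) (s : ℝ) :
    L2K N := (HasExpGrowth.of_test (slice_smooth h s)).dual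

theorem hasDerivAt_sliceDual
    (h : ContDiff ℝ ∞ (Function.uncurry φ) ∧ HasCompactSupport (Function.uncurry φ)) (s : ℝ) :
    HasDerivAt (sliceDual h) (sliceDual (timeD_smooth h) s) s := by
  obtain ⟨M, htaylor⟩ := exists_taylor_bound h
  refine hasDerivAt_iff_isLittleO.2 <| Asymptotics.IsBigO.trans_isLittleO
    (g := fun t : ℝ => ‖t - s‖ ^ 2) ?_ (Asymptotics.isLittleO_pow_sub_sub s one_lt_two)
  refine Asymptotics.IsBigO.of_bound (M * ‖(HasExpGrowth.const (E := Space N) 1).dual‖)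
    (Eventually.of_forall fun t => ?_)
  rw [norm_pow, norm_norm, mul_right_comm]
  exact HasExpGrowth.norm_dual_sub_sub_smul_le _ _ _ _ fun y => by
    simpa only [abs_one, mul_one, Real.norm_eq_abs] using htaylor s t y

theorem contDiff_one_sliceDual
    (h : ContDiff ℝ ∞ (Function.uncurry φ) ∧ HasCompactSupport (Function.uncurry φ)) :
    ContDiff ℝ 1 (sliceDual h) := by
  refine contDiff_one_iff_deriv.2 ⟨fun s => (hasDerivAt_sliceDual h s).differentiableAt, ?_⟩
  rw [funext fun s => (hasDerivAt_sliceDual h s).deriv]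
  exact continuous_iff_continuousAt.2 fun s =>
    (hasDerivAt_sliceDual (timeD_smooth h) s).continuousAt

theorem sliceDual_eq_zero
    (h : ContDiff ℝ ∞ (Function.uncurry φ) ∧ HasCompactSupport (Function.uncurry φ)) {s : ℝ}
    (hs : s ∉ Prod.fst '' tsupport (Function.uncurry φ)) : sliceDual h s = 0 := by
  rw [Lp.eq_zero_iff_ae_eq_zero]
  refine ae_weightMeasure_iff.2 ?_
  filter_upwards [(HasExpGrowth.of_test (slice_smooth h s)).coeFn_dual] with y hy
  rw [sliceDual, hy, slice_eq_zero hs, zero_div, Pi.zero_apply]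

theorem hasDerivAt_inner_sliceDual_heatS
    (h : ContDiff ℝ ∞ (Function.uncurry φ) ∧ HasCompactSupport (Function.uncurry φ)) (u : L2K N)
    {s : ℝ} (hs : 0 < s) :
    HasDerivAt (fun s => inner ℝ (sliceDual h s) (heatS N s u))
      (inner ℝ (sliceDual h s) (-heatG N hs u) +
        inner ℝ (sliceDual (timeD_smooth h) s) (heatS N s u)) s :=
  (hasDerivAt_sliceDual h s).inner ℝ (hasDerivAt_heatS hs u)

theorem integral_heatS_mul
    (h : ContDiff ℝ ∞ (Function.uncurry φ) ∧ HasCompactSupport (Function.uncurry φ)) (u : L2K N)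
    {s : ℝ} (hs : 0 < s) :
    ∫ y, heatS N s u y * (-deriv (fun σ => φ σ y) s - (Δ (φ s)) y
        + (N * φ s y + fderiv ℝ (φ s) y y) / 2 - N / 2 * φ s y) =
      -deriv (fun s => inner ℝ (sliceDual h s) (heatS N s u)) s := by
  have hφ := slice_smooth h s
  have hsplit (y : Space N) : heatS N s u y * (-deriv (fun σ => φ σ y) s - (Δ (φ s)) y
        + (N * φ s y + fderiv ℝ (φ s) y y) / 2 - N / 2 * φ s y) =
      heatS N s u y * adjointL (φ s) y - heatS N s u y * timeD φ s y -
        N / 2 * (heatS N s u y * φ s y) := by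
    rw [adjointL, timeD]
    ring
  have hintL := (HasExpGrowth.adjointL_of_test hφ).integrable_mul (heatS N s u)
  have hintD := (HasExpGrowth.of_test (slice_smooth (timeD_smooth h) s)).integrable_mul
    (heatS N s u)
  have hint := (HasExpGrowth.of_test hφ).integrable_mul (heatS N s u)
  simp only [hsplit]
  rw [integral_sub (hintL.sub' hintD) (hint.const_mul _), integral_sub hintL hintD,
    integral_const_mul, (isL_heatS hs u).weakL _ hφ.1 hφ.2,
    ← (HasExpGrowth.of_test hφ).inner_dual, ← (HasExpGrowth.of_test hφ).inner_dual,
    ← (HasExpGrowth.of_test (slice_smooth (timeD_smooth h) s)).inner_dual, inner_add_right,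
    real_inner_smul_right, (hasDerivAt_inner_sliceDual_heatS h u hs).deriv, inner_neg_right,
    sliceDual, sliceDual]
  ring

theorem isSolution_heatS (u : L2K N) : IsSolution u fun s => heatS N s u where
  continuousOn := (continuous_heatS u).continuousOn
  initial := by simp only [(isHeatSemigroup_heatS N).zero, ContinuousLinearMap.id_apply]
  equation φ hsmooth hcompact hpos := by
    have h := And.intro hsmooth hcompact
    set T := Prod.fst '' tsupport (Function.uncurry φ)
    have hT : IsCompact T := hcompact.image continuous_fst
    have hTpos : T ⊆ Ioi 0 := by
      rintro _ ⟨p, hp, rfl⟩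
      exact (hpos hp).1
    set F : ℝ → ℝ := fun s => inner ℝ (sliceDual h s) (heatS N s u)
    have hFzero : ∀ s ∉ T, F s = 0 := fun s hs => by
      simp only [F, sliceDual_eq_zero h hs, inner_zero_left]
    have hFT : tsupport F ⊆ T :=
      closure_minimal (fun s => not_imp_comm.1 (hFzero s)) hT.isClosed
    have hFsmooth : ContDiff ℝ 1 F := contMDiff_iff_contDiff.1 <| contMDiff_of_tsupport fun s hs =>
      ((contDiff_one_sliceDual h).contDiffAt.inner ℝ <|
        ((contDiffOn_diagonalSemigroup _ eigenvalue_nonneg u).contDiffAt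
          (Ioi_mem_nhds (hTpos (hFT hs)))).of_le (by simp)).contMDiffAt
    have hFcompact : HasCompactSupport F := hT.of_isClosed_subset (isClosed_tsupport F) hFT
    rw [setIntegral_congr_fun measurableSet_Ioi fun s hs => integral_heatS_mul h u hs,
      integral_neg, hFcompact.integral_Ioi_deriv_eq hFsmooth,
      hFzero 0 fun h0 => lt_irrefl (0 : ℝ) (hTpos h0), neg_zero, neg_zero]

end TestFunctions

/-! ### Distributions with vanishing derivative -/

section Antiderivative

theorem integrableOn_smul_of_tsupport_subset {X E : Type*} [TopologicalSpace X] [T2Space X]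
    [MeasurableSpace X] [OpensMeasurableSpace X] [NormedAddCommGroup E] [NormedSpace ℝ E]
    {μ : Measure X} [IsFiniteMeasureOnCompacts μ] {f : X → ℝ} {g : X → E} {s : Set X}
    (hs : MeasurableSet s) (hf : Continuous f) (hc : HasCompactSupport f) (hfs : tsupport f ⊆ s)
    (hg : ContinuousOn g s) : IntegrableOn (fun x => f x • g x) s μ := by
  refine IntegrableOn.of_forall_sdiff_eq_zero (s := tsupport f)
    ((hf.continuousOn.smul (hg.mono hfs)).integrableOn_compact hc) hs fun x hx => ?_
  rw [image_eq_zero_of_notMem_tsupport hx.2, zero_smul]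

theorem setIntegral_eq_integral_of_tsupport_subset {X E : Type*} [TopologicalSpace X]
    [MeasurableSpace X] [NormedAddCommGroup E] [NormedSpace ℝ E] {μ : Measure X} {f : X → E}
    {s : Set X} (hf : tsupport f ⊆ s) : ∫ x in s, f x ∂μ = ∫ x, f x ∂μ :=
  setIntegral_eq_integral_of_forall_compl_eq_zero fun _ hx =>
    image_eq_zero_of_notMem_tsupport fun h => hx (hf h)

theorem exists_tsupport_subset_Ioc {f : ℝ → ℝ} {a : ℝ} (hc : HasCompactSupport f)
    (hf : tsupport f ⊆ Ioi a) : ∃ b > a, ∃ c, tsupport f ⊆ Ioc b c := by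
  obtain ⟨c, hc⟩ := hc.isCompact.bddAbove
  obtain ⟨b, hab, hb⟩ := mem_nhdsGE_iff_exists_Ico_subset.1 <| mem_nhdsWithin_of_mem_nhds <|
    (isClosed_tsupport f).isOpen_compl.mem_nhds fun h => lt_irrefl a (hf h)
  obtain ⟨b', hab', hb'⟩ := exists_between (mem_Ioi.1 hab)
  refine ⟨b', hab', c, fun x hx => ⟨hb'.trans_le ?_, hc hx⟩⟩
  by_contra! hxb
  exact hb ⟨(hf hx).le, hxb⟩ hx

theorem tsupport_intervalIntegral_subset {f : ℝ → ℝ} {a b : ℝ}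
    (hf : Function.support f ⊆ Ioc a b) (hzero : ∫ x, f x = 0) :
    tsupport (fun s => ∫ x in a..s, f x) ⊆ Icc a b := by
  refine closure_minimal (fun s hs => ?_) isClosed_Icc
  contrapose! hs
  rw [Function.notMem_support]
  rcases not_and_or.1 hs with hsa | hsb
  · rw [intervalIntegral.integral_of_ge (not_le.1 hsa).le,
      setIntegral_eq_zero_of_forall_eq_zero fun x hx => ?_, neg_zero]
    exact Function.notMem_support.1 fun h => hx.2.not_gt (hf h).1
  · rw [← hzero]
    exact intervalIntegral.integral_eq_integral_of_support_subset
      (hf.trans (Ioc_subset_Ioc_right (not_le.1 hsb).le))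

theorem exists_antiderivative_of_integral_eq_zero {k : ℝ → ℝ} {a : ℝ} (hk : ContDiff ℝ ∞ k)
    (hc : HasCompactSupport k) (hs : tsupport k ⊆ Ioi a) (hzero : ∫ x, k x = 0) :
    ∃ θ : ℝ → ℝ, ContDiff ℝ ∞ θ ∧ HasCompactSupport θ ∧ tsupport θ ⊆ Ioi a ∧ deriv θ = k := by
  obtain ⟨b, hab, c, hbc⟩ := exists_tsupport_subset_Ioc hc hs
  have hd (x : ℝ) : HasDerivAt (fun s => ∫ x in b..s, k x) (k x) x :=
    (hk.continuous.integral_hasStrictDerivAt b x).hasDerivAt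
  have hderiv : deriv (fun s => ∫ x in b..s, k x) = k := funext fun x => (hd x).deriv
  have hsupp := tsupport_intervalIntegral_subset (subset_closure.trans hbc) hzero
  exact ⟨_, contDiff_infty_iff_deriv.2 ⟨fun x => (hd x).differentiableAt, hderiv.symm ▸ hk⟩,
    isCompact_Icc.of_isClosed_subset (isClosed_tsupport _) hsupp,
    hsupp.trans fun x hx => hab.trans_le hx.1, hderiv⟩

theorem exists_contDiff_integral_eq_one (a : ℝ) : ∃ η : ℝ → ℝ,
    ContDiff ℝ ∞ η ∧ HasCompactSupport η ∧ tsupport η ⊆ Ioi a ∧ ∫ x, η x = 1 := by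
  let bump : ContDiffBump (a + 1) := ⟨1 / 4, 1 / 2, by norm_num, by norm_num⟩
  refine ⟨bump.normed volume, bump.contDiff_normed, bump.hasCompactSupport_normed, ?_,
    bump.integral_normed⟩
  rw [bump.tsupport_normed_eq]
  intro x hx
  rw [Real.closedBall_eq_Icc] at hx
  exact (by simp only [bump]; linarith : a < a + 1 - bump.rOut).trans_le hx.1

theorem integral_smul_sub_eq_zero {g η : ℝ → ℝ} {a : ℝ} (hg : ContinuousOn g (Ioi a))
    (h : ∀ θ : ℝ → ℝ, ContDiff ℝ ∞ θ → HasCompactSupport θ → tsupport θ ⊆ Ioi a →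
      ∫ s in Ioi a, deriv θ s * g s = 0)
    (hη : ContDiff ℝ ∞ η) (hηc : HasCompactSupport η) (hηs : tsupport η ⊆ Ioi a)
    (hηone : ∫ x, η x = 1) {ψ : ℝ → ℝ} (hψ : ContDiff ℝ ∞ ψ) (hψc : HasCompactSupport ψ)
    (hψs : tsupport ψ ⊆ Ioi a) : ∫ x, ψ x • (g x - ∫ s in Ioi a, η s * g s) = 0 := by
  have hintψ : Integrable ψ := hψ.continuous.integrable_of_hasCompactSupport hψc
  have hintη : Integrable η := hη.continuous.integrable_of_hasCompactSupport hηc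
  have hψg : IntegrableOn (fun s => ψ s * g s) (Ioi a) :=
    integrableOn_smul_of_tsupport_subset measurableSet_Ioi hψ.continuous hψc hψs hg
  have hηg : IntegrableOn (fun s => η s * g s) (Ioi a) :=
    integrableOn_smul_of_tsupport_subset measurableSet_Ioi hη.continuous hηc hηs hg
  obtain ⟨θ, hθ, hθc, hθs, hθderiv⟩ := exists_antiderivative_of_integral_eq_zero
    (k := fun x => ψ x - (∫ x, ψ x) * η x) (hψ.sub (contDiff_const.mul hη))
    (hψc.sub hηc.mul_left)
    ((tsupport_sub _ _).trans (union_subset hψs (tsupport_mul_subset_right.trans hηs)))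
    (by rw [integral_sub hintψ (hintη.const_mul _), integral_const_mul, hηone, mul_one, sub_self])
  have hθg := h θ hθ hθc hθs
  simp only [hθderiv, sub_mul, mul_assoc] at hθg
  rw [integral_sub hψg (hηg.const_mul _), integral_const_mul] at hθg
  rw [← setIntegral_eq_integral_of_tsupport_subset ((tsupport_smul_subset_left _ _).trans hψs)]
  simp only [smul_eq_mul, mul_sub]
  rw [integral_sub hψg (hintψ.integrableOn.mul_const _), integral_mul_const,
    setIntegral_eq_integral_of_tsupport_subset hψs, hθg]

theorem exists_eqOn_const_of_integral_deriv_mul_eq_zero {g : ℝ → ℝ} {a : ℝ}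
    (hg : ContinuousOn g (Ioi a))
    (h : ∀ θ : ℝ → ℝ, ContDiff ℝ ∞ θ → HasCompactSupport θ → tsupport θ ⊆ Ioi a →
      ∫ s in Ioi a, deriv θ s * g s = 0) : ∃ c, EqOn g (fun _ => c) (Ioi a) := by
  obtain ⟨η, hη, hηc, hηs, hηone⟩ := exists_contDiff_integral_eq_one a
  refine ⟨∫ s in Ioi a, η s * g s,
    Measure.eqOn_open_of_ae_eq (μ := volume) ?_ isOpen_Ioi hg continuousOn_const⟩
  rw [EventuallyEq, ae_restrict_iff' measurableSet_Ioi]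
  filter_upwards [isOpen_Ioi.ae_eq_zero_of_integral_contDiff_smul_eq_zero
    ((hg.sub continuousOn_const).locallyIntegrableOn measurableSet_Ioi)
    fun ψ hψ hψc hψs => integral_smul_sub_eq_zero hg h hη hηc hηs hηone hψ hψc hψs] with x hx hxa
  exact sub_eq_zero.1 (hx hxa)

end Antiderivative

/-! ### Uniqueness -/

section Uniqueness

variable {N : ℕ} {u : L2K N} {w : ℝ → L2K N} {θ : ℝ → ℝ}

theorem laplacian_const_mul (c : ℝ) {ψ : Space N → ℝ} (h : ContDiff ℝ ∞ ψ) (y : Space N) :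
    (Δ fun y => c * ψ y) y = c * (Δ ψ) y :=
  InnerProductSpace.laplacian_smul c (contDiff_infty.1 h 2).contDiffAt

theorem tsupport_uncurry_mul_subset (θ : ℝ → ℝ) (ψ : Space N → ℝ) :
    tsupport (Function.uncurry fun s y => θ s * ψ y) ⊆ tsupport θ ×ˢ tsupport ψ :=
  closure_minimal (fun _ hp => ⟨subset_closure (left_ne_zero_of_mul hp),
    subset_closure (right_ne_zero_of_mul hp)⟩)
    ((isClosed_tsupport θ).prod (isClosed_tsupport ψ))

theorem integral_mul_tensor {s : ℝ} (hθ : DifferentiableAt ℝ θ s) {ψ : Space N → ℝ}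
    (hψ : ContDiff ℝ ∞ ψ ∧ HasCompactSupport ψ) (v : L2K N) :
    ∫ y, v y * (-deriv (fun σ => θ σ * ψ y) s - (Δ fun y => θ s * ψ y) y
        + (N * (θ s * ψ y) + fderiv ℝ (fun y => θ s * ψ y) y y) / 2 - N / 2 * (θ s * ψ y)) =
      inner ℝ (HasExpGrowth.adjointL_of_test hψ).dual (θ s • v) -
        inner ℝ (HasExpGrowth.of_test hψ).dual (deriv θ s • v + ((N : ℝ) / 2) • θ s • v) := by
  have hsplit (y : Space N) : v y * (-deriv (fun σ => θ σ * ψ y) s - (Δ fun y => θ s * ψ y) y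
      + (N * (θ s * ψ y) + fderiv ℝ (fun y => θ s * ψ y) y y) / 2 - N / 2 * (θ s * ψ y)) =
      θ s * (v y * adjointL ψ y) - (deriv θ s + N / 2 * θ s) * (v y * ψ y) := by
    rw [laplacian_const_mul _ hψ.1, fderiv_const_mul (hψ.1.differentiable (by simp) y),
      deriv_mul_const hθ, smul_apply, adjointL, smul_eq_mul]
    ring
  simp only [hsplit]
  rw [integral_sub (((HasExpGrowth.adjointL_of_test hψ).integrable_mul v).const_mul _)
      (((HasExpGrowth.of_test hψ).integrable_mul v).const_mul _), integral_const_mul,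
    integral_const_mul, ← HasExpGrowth.inner_dual (HasExpGrowth.adjointL_of_test hψ),
    ← HasExpGrowth.inner_dual (HasExpGrowth.of_test hψ), smul_smul, ← add_smul,
    real_inner_smul_right, real_inner_smul_right]

theorem IsSolution.integral_inner_eq_zero (hw : IsSolution u w)
    (hθ : ContDiff ℝ ∞ θ) (hθc : HasCompactSupport θ) (hθs : tsupport θ ⊆ Ioi 0)
    {ψ : Space N → ℝ} (hψ : ContDiff ℝ ∞ ψ ∧ HasCompactSupport ψ) :
    ∫ s in Ioi (0 : ℝ), (inner ℝ (HasExpGrowth.adjointL_of_test hψ).dual (θ s • w s) -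
      inner ℝ (HasExpGrowth.of_test hψ).dual
        (deriv θ s • w s + ((N : ℝ) / 2) • θ s • w s)) = 0 := by
  have hsub := tsupport_uncurry_mul_subset θ ψ
  refine Eq.trans (setIntegral_congr_fun measurableSet_Ioi fun s _ =>
    (integral_mul_tensor (hθ.differentiable (by simp) s) hψ (w s)).symm) ?_
  exact hw.equation (fun s y => θ s * ψ y)
    ((hθ.comp contDiff_fst).mul (hψ.1.comp contDiff_snd))
    ((hθc.prod hψ.2).of_isClosed_subset (isClosed_tsupport _) hsub)
    (hsub.trans (prod_mono hθs (subset_univ _)))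

theorem IsSolution.integrableOn_smul (hw : IsSolution u w) (hθ : Continuous θ)
    (hθc : HasCompactSupport θ) (hθs : tsupport θ ⊆ Ioi 0) :
    IntegrableOn (fun s => θ s • w s) (Ioi 0) :=
  integrableOn_smul_of_tsupport_subset measurableSet_Ioi hθ hθc hθs
    (hw.continuousOn.mono Ioi_subset_Ici_self)

theorem IsSolution.integrableOn_deriv_smul_add (hw : IsSolution u w) (hθ : ContDiff ℝ ∞ θ)
    (hθc : HasCompactSupport θ) (hθs : tsupport θ ⊆ Ioi 0) (c : ℝ) :
    IntegrableOn (fun s => deriv θ s • w s + c • θ s • w s) (Ioi 0) :=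
  (hw.integrableOn_smul (hθ.continuous_deriv (by simp)) hθc.deriv
    ((tsupport_deriv_subset (f := θ)).trans hθs)).add
    ((hw.integrableOn_smul hθ.continuous hθc hθs).smul c)

theorem IsSolution.weakL_integral (hw : IsSolution u w) (hθ : ContDiff ℝ ∞ θ)
    (hθc : HasCompactSupport θ) (hθs : tsupport θ ⊆ Ioi 0) :
    WeakL (∫ s in Ioi (0 : ℝ), θ s • w s)
      (∫ s in Ioi (0 : ℝ), (deriv θ s • w s + ((N : ℝ) / 2) • θ s • w s)) := by
  have hint := hw.integrableOn_smul hθ.continuous hθc hθs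
  have hint' := hw.integrableOn_deriv_smul_add hθ hθc hθs (N / 2)
  refine weakL_iff.2 fun ψ hψ => ?_
  rw [← integral_inner hint, ← integral_inner hint', ← sub_eq_zero,
    ← integral_sub (hint.const_inner _) (hint'.const_inner _)]
  exact hw.integral_inner_eq_zero hθ hθc hθs hψ

theorem IsSolution.integral_deriv_mul_inner (hw : IsSolution u w) (hθ : ContDiff ℝ ∞ θ)
    (hθc : HasCompactSupport θ) (hθs : tsupport θ ⊆ Ioi 0) (β : Fin N → ℕ) :
    ∫ s in Ioi (0 : ℝ), (deriv θ s - eigenvalue β * θ s) * inner ℝ (hermiteE β) (w s) = 0 := by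
  have hint := hw.integrableOn_smul hθ.continuous hθc hθs
  have hint' := hw.integrableOn_deriv_smul_add hθ hθc hθs (N / 2)
  have hcoeff := (hw.weakL_integral hθ hθc hθs).inner_hermiteE β
  rw [← integral_inner hint, ← integral_inner hint', ← integral_const_mul, ← sub_eq_zero,
    ← integral_sub (hint'.const_inner _) ((hint.const_inner _).const_mul _)] at hcoeff
  refine (setIntegral_congr_fun measurableSet_Ioi fun s _ => ?_).trans hcoeff
  simp only [inner_add_right, real_inner_smul_right]
  ring

theorem IsSolution.inner_hermiteE_eq (hw : IsSolution u w) (β : Fin N → ℕ) {s : ℝ} (hs : 0 ≤ s) :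
    inner ℝ (hermiteE β) (w s) = Real.exp (-(eigenvalue β * s)) * inner ℝ (hermiteE β) u := by
  set g : ℝ → ℝ := fun s => Real.exp (eigenvalue β * s) * inner ℝ (hermiteE β) (w s)
  have hexp : ContDiff ℝ ∞ fun s : ℝ => Real.exp (eigenvalue β * s) :=
    (contDiff_const.mul contDiff_id).exp
  have hg : ContinuousOn g (Ici 0) :=
    hexp.continuous.continuousOn.mul (continuousOn_const.inner hw.continuousOn)
  have hweak (θ : ℝ → ℝ) (hθ : ContDiff ℝ ∞ θ) (hθc : HasCompactSupport θ)
      (hθs : tsupport θ ⊆ Ioi 0) : ∫ s in Ioi (0 : ℝ), deriv θ s * g s = 0 := by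
    refine (setIntegral_congr_fun measurableSet_Ioi fun s _ => ?_).trans <|
      hw.integral_deriv_mul_inner (hθ.mul hexp) hθc.mul_right
        (tsupport_mul_subset_left.trans hθs) β
    have hderiv := ((hθ.differentiable (by simp) s).hasDerivAt.fun_mul
      ((hasDerivAt_id s).const_mul (eigenvalue β)).exp).deriv
    simp only [id_eq, mul_one] at hderiv
    simp only [g, hderiv]
    ring
  obtain ⟨c, hc⟩ := exists_eqOn_const_of_integral_deriv_mul_eq_zero
    (hg.mono Ioi_subset_Ici_self) hweak
  have hconst : EqOn g (fun _ => c) (Ici 0) :=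
    hc.of_subset_closure hg continuousOn_const Ioi_subset_Ici_self (closure_Ioi 0).ge
  have hgs : g s = g 0 := (hconst hs).trans (hconst self_mem_Ici).symm
  simp only [g, mul_zero, Real.exp_zero, one_mul, hw.initial] at hgs
  rw [← hgs, ← mul_assoc, ← Real.exp_add, neg_add_cancel, Real.exp_zero, one_mul]

theorem IsSolution.eq_heatS (hw : IsSolution u w) {s : ℝ} (hs : 0 ≤ s) :
    w s = heatS N s u :=
  ext_inner_hermiteE fun β => by rw [hw.inner_hermiteE_eq β hs, inner_heatS hs]

end Uniqueness

end SimilarityHeat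

open SimilarityHeat in
theorem theorem3p2_general (N : ℕ) :
    ∃ S : ℝ → L2K N →L[ℝ] L2K N,
      IsHeatSemigroup S ∧
      (∀ u₀ : L2K N,
        IsSolution u₀ (fun s => S s u₀) ∧
        (∀ w : ℝ → L2K N, IsSolution u₀ w → ∀ s, 0 ≤ s → w s = S s u₀) ∧
        (∀ m : ℕ, SmoothInHK m (fun s => S s u₀)) ∧
        (∀ s, 0 < s → ∃ f : L2K N, IsL (S s u₀) f ∧
          HasDerivAt (fun σ => S σ u₀) (-(f - ((N : ℝ) / 2) • S s u₀)) s)) ∧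
      (∀ u₀ : L2K N, ∀ s, 0 ≤ s → inner ℝ (S s u₀) (phiOne N) = inner ℝ u₀ (phiOne N)) ∧
      (∃ C : ℝ, 0 < C ∧ ∀ u₀ ∈ (firstEigenspace N)ᗮ, ∀ s, 0 ≤ s →
        ‖S s u₀‖ ≤ C * Real.exp (-s / 2) * ‖u₀‖) ∧
      (∀ m : ℕ, ∃ C : ℝ, 0 < C ∧ ∀ u₀ ∈ (firstEigenspace N)ᗮ, ∀ s, 1 ≤ s →
        ∃ V : HK N m, toL2K V = S s u₀ ∧ ‖V‖ ≤ C * Real.exp (-s / 2) * ‖u₀‖) ∧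
      (∀ u₀ : L2K N, ∀ s, 0 < s →
        ∃ f : L2K N, IsL (S s u₀) f ∧
          ‖f - ((N : ℝ) / 2) • S s u₀‖ ≤ 1 / (√2 * s) * ‖u₀‖) ∧
      (∀ u₀ : L2K N, ∀ s, 0 < s →
        ∃ g : Fin N → L2K N, (∀ i, HasWeakDeriv (Pi.single i 1) (S s u₀) (g i)) ∧
          (∑ i, ‖g i‖ ^ 2) - (N : ℝ) / 2 * ‖S s u₀‖ ^ 2 ≤ 1 / (2 * s) * ‖u₀‖ ^ 2) := by
  refine ⟨heatS N, isHeatSemigroup_heatS N, fun u₀ => ⟨isSolution_heatS u₀,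
      fun _ hw _ hs => hw.eq_heatS hs, fun m => smoothInHK_heatS m u₀, fun s hs => ?_⟩,
    fun u₀ _ hs => inner_heatS_phiOne hs u₀, ⟨1, one_pos, fun u₀ hu s hs => ?_⟩,
    exists_norm_HK_le N, fun u₀ s hs => ?_, fun u₀ _ hs => exists_gradient_heatS hs u₀⟩
  · exact ⟨_, isL_heatS hs u₀, by simpa only [add_sub_cancel_right] using hasDerivAt_heatS hs u₀⟩
  · simpa only [one_mul] using norm_heatS_le_of_mem_orthogonal hu hs
  · exact ⟨_, isL_heatS hs u₀, by simpa only [add_sub_cancel_right] using norm_heatG_le hs u₀⟩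

open SimilarityHeat in
theorem theorem3p2 (N : ℕ) (hN : 1 ≤ N) :
    ∃ S : ℝ → L2K N →L[ℝ] L2K N,
      IsHeatSemigroup S ∧
      -- (i)
      (∀ u₀ : L2K N,
        IsSolution u₀ (fun s => S s u₀) ∧
        (∀ w : ℝ → L2K N, IsSolution u₀ w → ∀ s, 0 ≤ s → w s = S s u₀) ∧
        (∀ m : ℕ, SmoothInHK m (fun s => S s u₀)) ∧
        (∀ s, 0 < s → ∃ f : L2K N, IsL (S s u₀) f ∧
          HasDerivAt (fun σ => S σ u₀) (-(f - ((N : ℝ) / 2) • S s u₀)) s)) ∧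
      -- (ii)
      (∀ u₀ : L2K N, ∀ s, 0 ≤ s → inner ℝ (S s u₀) (phiOne N) = inner ℝ u₀ (phiOne N)) ∧
      -- (iii)
      (∃ C : ℝ, 0 < C ∧ ∀ u₀ ∈ (firstEigenspace N)ᗮ, ∀ s, 0 ≤ s →
        ‖S s u₀‖ ≤ C * Real.exp (-s / 2) * ‖u₀‖) ∧
      (∀ m : ℕ, ∃ C : ℝ, 0 < C ∧ ∀ u₀ ∈ (firstEigenspace N)ᗮ, ∀ s, 1 ≤ s →
        ∃ V : HK N m, toL2K V = S s u₀ ∧ ‖V‖ ≤ C * Real.exp (-s / 2) * ‖u₀‖) ∧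
      -- (iv)
      (∀ u₀ ∈ (firstEigenspace N)ᗮ, ∀ s, 0 < s →
        ∃ f : L2K N, IsL (S s u₀) f ∧
          ‖f - ((N : ℝ) / 2) • S s u₀‖ ≤ 1 / (√2 * s) * ‖u₀‖) ∧
      (∀ u₀ ∈ (firstEigenspace N)ᗮ, ∀ s, 0 < s →
        ∃ g : Fin N → L2K N, (∀ i, HasWeakDeriv (Pi.single i 1) (S s u₀) (g i)) ∧
          (∑ i, ‖g i‖ ^ 2) - (N : ℝ) / 2 * ‖S s u₀‖ ^ 2 ≤ 1 / (2 * s) * ‖u₀‖ ^ 2) := by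
  obtain ⟨S, hS, hsol, hphi, hdecay, hsobolev, hgen, hgrad⟩ := theorem3p2_general N
  exact ⟨S, hS, hsol, hphi, hdecay, hsobolev, fun u₀ _ => hgen u₀, fun u₀ _ => hgrad u₀⟩
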